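/- There exist universal constants $C_1,C_2>0$ such that the following holds. Let $G=(V,E)$ be one of the following graphs. (1D) $V=\{1,\dots,n\}$, and distinct $i,j$ are joined by an edge iff $|i-j|\le r$, where $r$ is an integer with $1\le r\le n$. (2D) $n=m^2$, $V=\{1,\dots,m\}^2$, and distinct $i=(i_1,i_2)$, $j=(j_1,j_2)$ are joined by an edge iff $|i_1-j_1|+|i_2-j_2|\le r$, where $r$ is an integer with $1\le r\le 2m$. Nodes are ordered lexicographically. Let $\theta^\star\in\mathbb R^V$ satisfy $\sum_{i\in V}\theta^\star_i=0$, and let $\kappa_E\ge 1$ be such that $|\theta^\star_i-\theta^\star_j|\le\log\kappa_E$ for all $(i,j)\in E$. For every edge $(i,j)\in E$ with $i<j$ one observes $L\ge 1$ samples $y_{i,j}^{(1)},\dots,y_{i,j}^{(L)}$; all samples on all edges are independent, and $\mathbb P(y_{i,j}^{(\ell)}=1)=1-\mathbb P(y_{i,j}^{(\ell)}=0)=1/(1+e^{-(\theta^\star_i-\theta^\star_j)})$. A maximum likelihood estimate (MLE) is a minimizer, over all $\theta\in\mathbb R^V$ with $\sum_{i\in V}\theta_i=0$, of $$\mathcal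 L(\theta)=\sum_{(i,j)\in E,\ i<j}\ \sum_{\ell=1}^{L}\Big(-y_{i,j}^{(\ell)}(\theta_i-\theta_j)+\log\big(1+e^{\theta_i-\theta_j}\big)\Big).$$ Let $0<\delta<1$, and suppose that $$rL\ \ge\ C_1\,\kappa_E^5\, n\log(n/\delta)\ \text{ in case (1D)},\qquad r^2L\ \ge\ C_1\,\kappa_E^5\, n\log(n/\delta)\ \text{ in case (2D)}.$$ Then, with probability at least $1-\delta$, a (finite) MLE $\theta^{\mathsf{MLE}}$ exists and is unique, and it satisfies, for all $k,l\in V$, $$\big|(\theta^{\mathsf{MLE}}_k-\theta^{\mathsf{MLE}}_l)-(\theta^\star_k-\theta^\star_l)\big|\ \le\ \begin{cases}C_2\,\kappa_E\sqrt{\big(\tfrac{n}{r^2}+1\big)\tfrac{1}{rL}\log\tfrac n\delta} & \text{in case (1D)},\\[4pt] C_2\,\kappa_E\sqrt{\big(\tfrac{\log n}{r^2}+1\big)\tfrac{1}{r^2L}\log\tfrac n\delta} & \text{in case (2D)}.\end{cases}$$ -/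

import Mathlib

open MeasureTheory ProbabilityTheory

namespace BTL

/-- The one-dimensional grid with `n` nodes and radius `r` (edge probability one): two distinct
nodes are adjacent exactly when their positions differ by at most `r`. -/
def grid1D (n r : ℕ) : SimpleGraph (Fin n) where
  Adj i j := i ≠ j ∧ |(i.val : ℤ) - (j.val : ℤ)| ≤ (r : ℤ)
  symm := ⟨fun i j h => ⟨h.1.symm, by rw [abs_sub_comm]; exact h.2⟩⟩
  loopless := ⟨fun i h => h.1 rfl⟩

/-- The two-dimensional `m × m` grid (so `n = m ^ 2` nodes) with radius `r` (edge probability one):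
two distinct nodes are adjacent exactly when their `ℓ₁` distance is at most `r`. The nodes carry the
lexicographic order, which serves only to orient every edge once. -/
def grid2D (m r : ℕ) : SimpleGraph (Fin m ×ₗ Fin m) where
  Adj i j := i ≠ j ∧
    |((ofLex i).1.val : ℤ) - ((ofLex j).1.val : ℤ)|
      + |((ofLex i).2.val : ℤ) - ((ofLex j).2.val : ℤ)| ≤ (r : ℤ)
  symm := ⟨fun i j h => ⟨h.1.symm, by
    rw [abs_sub_comm ((ofLex j).1.val : ℤ), abs_sub_comm ((ofLex j).2.val : ℤ)]; exact h.2⟩⟩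
  loopless := ⟨fun i h => h.1 rfl⟩

section Model

variable {V : Type*} [LinearOrder V]

/-- The edges `(i, j)` of `G`, each listed once, with `i < j`. -/
abbrev OrientedEdge (G : SimpleGraph V) : Type _ :=
  {e : V × V // G.Adj e.1 e.2 ∧ e.1 < e.2}

/-- `y e l`, for `e = (i, j)` an edge with `i < j` and `l < L`, are independent Bernoulli samples
with `P (y e l = 1) = σ (θ i - θ j) = 1 - P (y e l = 0)`: the data of the Bradley-Terry-Luce model
with score vector `θ` and `L` comparisons on each edge of `G`. -/
structure IsSample {Ω : Type*} [MeasurableSpace Ω] (P : Measure Ω) (G : SimpleGraph V)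
    (L : ℕ) (θ : V → ℝ) (y : OrientedEdge G → Fin L → Ω → ℝ) : Prop where
  measurable : ∀ e l, Measurable (y e l)
  prob_one : ∀ e l, P {ω | y e l ω = 1} = ENNReal.ofReal (Real.sigmoid (θ e.1.1 - θ e.1.2))
  prob_zero : ∀ e l, P {ω | y e l ω = 0} = ENNReal.ofReal (1 - Real.sigmoid (θ e.1.1 - θ e.1.2))
  indep : iIndepFun (fun x : OrientedEdge G × Fin L => y x.1 x.2) P

variable [Fintype V]

open scoped Classical in
/-- The negative log-likelihood of the score vector `θ`, given the observed outcomes `y`. -/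
noncomputable def loss (G : SimpleGraph V) (L : ℕ) (y : OrientedEdge G → Fin L → ℝ)
    (θ : V → ℝ) : ℝ :=
  ∑ e : OrientedEdge G, ∑ l : Fin L,
    (-(y e l) * (θ e.1.1 - θ e.1.2) + Real.log (1 + Real.exp (θ e.1.1 - θ e.1.2)))

/-- `θ` is a (finite) minimizer of the negative log-likelihood over all real score vectors whose
entries sum to zero, i.e. a maximum likelihood estimate. -/
def IsMLE (G : SimpleGraph V) (L : ℕ) (y : OrientedEdge G → Fin L → ℝ) (θ : V → ℝ) : Prop :=
  ∑ i, θ i = 0 ∧ IsMinOn (loss G L y) {θ' : V → ℝ | ∑ i, θ' i = 0} θ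

end Model

end BTL

/-! Effective resistance governs the error. Let H be the Laplacian of G with weights L σ'(θ*_i -
θ*_j). At a stationary point θ near θ* a Taylor expansion gives H(θ - θ*) = noise - remainder, so θ
- θ* = p - q, where p and q are the representers of the noise and of the quadratic remainder for the
Laplacian form. If ρ(k,l) bounds the effective resistance between k and l in the unweighted graph,
the representer of v ↦ v k - v l has energy at most ρ(k,l)/c², where c = L/(4κ) bounds the weights
below (`sum_sq_representer_le`). Hoeffding's inequality then gives |p k - p l| ≲ κ √(ρ(k,l)
log(n/δ)/L) for all pairs at once, and Cauchy-Schwarz gives the same bound for q, provided κ⁴ R² |E|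
log(n/δ)/L is small, R being the resistance bound across edges.

That θ - θ* = p - q really occurs is shown variationally in `exists_strict_minimizer`: minimize over
the compact set of scores whose edge errors are at most a given radius. The point θ* + p - q lies in
this convex set, and moving towards it decreases the loss at rate the H-energy of the displacement.
So the minimizer is that point, its gradient vanishes, and strict convexity makes it the unique
global minimizer. `mle_error_of_resistance_bound` adds the probability.

On the grids, with q = r or q = r², there are O(nq) edges, each of resistance O(1/q), so R²|E| =
O(n/q) and the sample size assumption is what is needed (`mle_error_of_locality`). Resistances are
bounded by cutting the grid into blocks of side comparable to r: averages over neighbouring blocks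
are compared through all edges between the blocks. This leaves a path in dimension one
(`grid1D_resistance`) and a square lattice in dimension two (`grid2D_resistance`), where resistance
is logarithmic (`sq_sub_rowAverage_zero_le`). -/

namespace BTL

/-! ### Scalar estimates for the logistic function. -/

section Scalar

lemma abs_sigmoid_sub_le (a b : ℝ) : |Real.sigmoid b - Real.sigmoid a| ≤ |b - a| := by
  have h := (convex_univ (𝕜 := ℝ) (E := ℝ)).norm_image_sub_le_of_norm_hasDerivWithin_le
    (f := Real.sigmoid) (f' := fun x => Real.sigmoid x * (1 - Real.sigmoid x)) (C := 1) (x := a)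
    (y := b) (fun x _ => (Real.hasDerivAt_sigmoid x).hasDerivWithinAt) ?_ trivial trivial
  · simpa using h
  · intro x _
    have h0 := Real.sigmoid_pos x
    have h1 := Real.sigmoid_lt_one x
    rw [Real.norm_eq_abs, abs_of_nonneg (by nlinarith)]
    nlinarith

/-- The mean value inequality for σ(x) - σ'(a) x: its derivative factors as (σ(x) - σ(a))(1 - σ(x) -
σ(a)), where the second factor has modulus at most 1 and the first at most |x - a|. -/
lemma abs_sigmoid_taylor_le (a u : ℝ) :
    |Real.sigmoid (a + u) - Real.sigmoid a - Real.sigmoid a * (1 - Real.sigmoid a) * u| ≤ u ^ 2 := by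
  have h := (convex_closedBall a |u|).norm_image_sub_le_of_norm_hasDerivWithin_le
    (f := fun x => Real.sigmoid x - Real.sigmoid a * (1 - Real.sigmoid a) * x)
    (f' := fun x => Real.sigmoid x * (1 - Real.sigmoid x) -
      Real.sigmoid a * (1 - Real.sigmoid a)) (C := |u|) (x := a) (y := a + u)
    (fun x _ => ((Real.hasDerivAt_sigmoid x).sub
      (by simpa using (hasDerivAt_id x).const_mul _)).hasDerivWithinAt) ?_ (by simp) (by simp)
  · simp only [Real.norm_eq_abs, add_sub_cancel_left] at h
    calc _ = |Real.sigmoid (a + u) - Real.sigmoid a * (1 - Real.sigmoid a) * (a + u) -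
          (Real.sigmoid a - Real.sigmoid a * (1 - Real.sigmoid a) * a)| := by congr 1; ring
      _ ≤ |u| * |u| := h
      _ = u ^ 2 := by rw [← sq, sq_abs]
  · intro x hx
    rw [mem_closedBall_iff_norm, Real.norm_eq_abs] at hx
    have h0 := Real.sigmoid_pos x
    have h1 := Real.sigmoid_lt_one x
    have h2 := Real.sigmoid_pos a
    have h3 := Real.sigmoid_lt_one a
    rw [Real.norm_eq_abs, show Real.sigmoid x * (1 - Real.sigmoid x) -
      Real.sigmoid a * (1 - Real.sigmoid a) =
      (Real.sigmoid x - Real.sigmoid a) * (1 - Real.sigmoid x - Real.sigmoid a) by ring, abs_mul]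
    calc _ ≤ |u| * 1 := mul_le_mul ((abs_sigmoid_sub_le a x).trans hx)
          (abs_le.2 ⟨by linarith, by linarith⟩) (abs_nonneg _) (abs_nonneg _)
      _ = |u| := mul_one _

lemma inv_four_mul_le_sigmoid_deriv {a κ : ℝ} (hκ : 1 ≤ κ) (ha : |a| ≤ Real.log κ) :
    1 / (4 * κ) ≤ Real.sigmoid a * (1 - Real.sigmoid a) := by
  have key : ∀ b : ℝ, 0 ≤ b → b ≤ Real.log κ →
      1 / (4 * κ) ≤ Real.sigmoid b * (1 - Real.sigmoid b) := by
    intro b hb hbκ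
    have h1 : 1 / 2 ≤ Real.sigmoid b := by
      have := Real.sigmoid_le hb
      rw [Real.sigmoid_zero] at this
      linarith
    have h2 : 1 / κ ≤ Real.exp (-b) := by
      rw [Real.exp_neg, ← one_div]
      exact one_div_le_one_div_of_le (Real.exp_pos _)
        ((Real.le_log_iff_exp_le (by linarith)).1 hbκ)
    -- Now σ(b)(1 - σ(b)) = σ(b)² e^{-b}, with σ(b) ≥ 1/2 and e^{-b} ≥ 1/κ.
    rw [← Real.sigmoid_neg, ← Real.sigmoid_mul_rexp_neg]
    calc 1 / (4 * κ) = 1 / 2 * (1 / 2 * (1 / κ)) := by field_simp; norm_num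
      _ ≤ _ := by gcongr
  rcases le_total 0 a with h | h
  · exact key a h (by rwa [abs_of_nonneg h] at ha)
  · have := key (-a) (by linarith) (by rwa [abs_of_nonpos h] at ha)
    rw [Real.sigmoid_neg] at this
    linarith

/-- Strict convexity of the softplus reduces to that of exp, applied at 0 and b - a with weights 1 -
σ(a) and σ(a). -/
lemma log_one_add_exp_tangent_lt {a b : ℝ} (hab : a ≠ b) :
    Real.log (1 + Real.exp a) + Real.sigmoid a * (b - a) < Real.log (1 + Real.exp b) := by
  have h0 := Real.sigmoid_pos a
  have h1 := Real.sigmoid_lt_one a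
  have hp : (0 : ℝ) < 1 + Real.exp a := by positivity
  have hs : Real.sigmoid a * (1 + Real.exp a) = Real.exp a := by
    rw [Real.sigmoid_def, Real.exp_neg]
    have := Real.exp_pos a
    field_simp
    ring
  have hc := strictConvexOn_exp.2 (Set.mem_univ 0) (Set.mem_univ (b - a))
    (by intro h; exact hab (by linarith)) (sub_pos.2 h1) h0 (by ring)
  simp only [smul_eq_mul, mul_zero, zero_add, Real.exp_zero, mul_one] at hc
  rw [Real.lt_log_iff_exp_lt (by positivity), Real.exp_add, Real.exp_log hp]
  calc _ < (1 + Real.exp a) * (1 - Real.sigmoid a + Real.sigmoid a * Real.exp (b - a)) := by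
        gcongr
    _ = (1 + Real.exp a) - Real.sigmoid a * (1 + Real.exp a) +
        Real.sigmoid a * (1 + Real.exp a) * Real.exp (b - a) := by ring
    _ = 1 + Real.exp b := by rw [hs, ← Real.exp_add]; ring_nf

lemma log_one_add_exp_tangent_le (a b : ℝ) :
    Real.log (1 + Real.exp a) + Real.sigmoid a * (b - a) ≤ Real.log (1 + Real.exp b) := by
  rcases eq_or_ne a b with rfl | h
  · simp
  · exact (log_one_add_exp_tangent_lt h).le

lemma log_one_add_exp_le (a b : ℝ) :
    Real.log (1 + Real.exp b) ≤
      Real.log (1 + Real.exp a) + Real.sigmoid a * (b - a) + (b - a) ^ 2 := by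
  have h := log_one_add_exp_tangent_le b a
  have h2 : (Real.sigmoid b - Real.sigmoid a) * (b - a) ≤ (b - a) ^ 2 := by
    calc _ ≤ |(Real.sigmoid b - Real.sigmoid a) * (b - a)| := le_abs_self _
      _ = |Real.sigmoid b - Real.sigmoid a| * |b - a| := abs_mul _ _
      _ ≤ |b - a| * |b - a| :=
          mul_le_mul_of_nonneg_right (abs_sigmoid_sub_le a b) (abs_nonneg _)
      _ = _ := by rw [← sq, sq_abs]
  linarith

end Scalar

/-! ### Weighted Laplacians and effective resistance. -/

section Weighted

variable {V ι : Type*} [Fintype ι]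

/-- The bilinear form of the weighted graph Laplacian with edges `(s e, t e)` of weight `w e`. -/
noncomputable def laplacianForm (s t : ι → V) (w : ι → ℝ) (x v : V → ℝ) : ℝ :=
  ∑ e, w e * (x (s e) - x (t e)) * (v (s e) - v (t e))

lemma laplacianForm_comm (s t : ι → V) (w : ι → ℝ) (x v : V → ℝ) :
    laplacianForm s t w x v = laplacianForm s t w v x :=
  Finset.sum_congr rfl fun _ _ => by ring

lemma laplacianForm_sub_left (s t : ι → V) (w : ι → ℝ) (x x' v : V → ℝ) :
    laplacianForm s t w (x - x') v = laplacianForm s t w x v - laplacianForm s t w x' v := by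
  simp only [laplacianForm, ← Finset.sum_sub_distrib, Pi.sub_apply]
  exact Finset.sum_congr rfl fun _ _ => by ring

/-- A functional that kills constants is represented by the Laplacian form of a connected graph. -/
lemma exists_laplacianForm_eq [Fintype V] [Nonempty V] (s t : ι → V)
    {w : ι → ℝ} (hw : ∀ e, 0 < w e)
    (hconn : ∀ x : V → ℝ, (∀ e, x (s e) = x (t e)) → ∀ k l, x k = x l)
    (φ : (V → ℝ) →ₗ[ℝ] ℝ) (hφ : φ 1 = 0) :
    ∃ x : V → ℝ, ∑ i, x i = 0 ∧ ∀ v, laplacianForm s t w x v = φ v := by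
  let D : ι → Module.Dual ℝ (V → ℝ) := fun e =>
    LinearMap.proj (R := ℝ) (φ := fun _ : V => ℝ) (s e) - LinearMap.proj (t e)
  let S : Module.Dual ℝ (V → ℝ) := ∑ i, LinearMap.proj i
  have hD : ∀ e x, D e x = x (s e) - x (t e) := fun e x => rfl
  have hS : ∀ x, S x = ∑ i, x i := fun x => by simp [S]
  -- The rank-one term removes the constants from the kernel, so connectedness makes `A` injective,
  -- hence bijective onto the dual.
  let A : (V → ℝ) →ₗ[ℝ] Module.Dual ℝ (V → ℝ) :=
    ∑ e, w e • (D e).smulRight (D e) + S.smulRight S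
  have hA : ∀ x v, A x v = laplacianForm s t w x v + (∑ i, x i) * ∑ i, v i := by
    intro x v
    simp [A, hD, hS, laplacianForm, LinearMap.sum_apply, mul_assoc]
  have hinj : Function.Injective A := by
    rw [← LinearMap.ker_eq_bot, LinearMap.ker_eq_bot']
    intro x hx
    have h0 := hA x x
    rw [hx] at h0
    have hnn : ∀ e ∈ Finset.univ, 0 ≤ w e * (x (s e) - x (t e)) * (x (s e) - x (t e)) :=
      fun e _ => by
        have := (hw e).le
        rw [mul_assoc]
        exact mul_nonneg this (mul_self_nonneg _)
    have h1 : 0 ≤ laplacianForm s t w x x := Finset.sum_nonneg hnn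
    have h2 := mul_self_nonneg (∑ i, x i)
    simp only [LinearMap.zero_apply] at h0
    have h3 : laplacianForm s t w x x = 0 := by linarith
    have h4 : (∑ i, x i) = 0 := mul_self_eq_zero.1 (by linarith)
    have h5 := (Finset.sum_eq_zero_iff_of_nonneg hnn).1 h3
    have h6 : ∀ k l, x k = x l := hconn x fun e => by
      have := h5 e (Finset.mem_univ e)
      rw [mul_assoc] at this
      exact sub_eq_zero.1 (mul_self_eq_zero.1
        ((mul_eq_zero.1 this).resolve_left (hw e).ne'))
    funext k
    have : ∑ i, x i = Fintype.card V * x k := by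
      rw [Finset.sum_congr rfl (fun i _ => h6 i k)]
      simp
    rw [h4] at this
    simpa using this.symm
  have hsurj : Function.Surjective A :=
    (LinearMap.injective_iff_surjective_of_finrank_eq_finrank
      (Subspace.dual_finrank_eq).symm).1 hinj
  obtain ⟨x, hx⟩ := hsurj φ
  -- Testing against the constant 1 kills the Laplacian part; `φ 1 = 0` forces the rank-one part to
  -- vanish.
  have h1 : ∑ i, x i = 0 := by
    have := hA x 1
    rw [hx, hφ] at this
    simpa [laplacianForm] using this
  refine ⟨x, h1, fun v => ?_⟩
  have := hA x v
  rw [hx, h1, zero_mul, add_zero] at this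
  exact this.symm

/-- The energy of the representer of `v ↦ v k - v l` is at most the squared effective resistance. -/
lemma sum_sq_representer_le (s t : ι → V) {w : ι → ℝ} {c ρ : ℝ} (hc : 0 < c) (hρ0 : 0 ≤ ρ)
    (hw : ∀ e, c ≤ w e) {k l : V} {g : V → ℝ}
    (hg : ∀ v, laplacianForm s t w g v = v k - v l)
    (hρ : ∀ x : V → ℝ, (x k - x l) ^ 2 ≤ ρ * ∑ e, (x (s e) - x (t e)) ^ 2) :
    ∑ e, (g (s e) - g (t e)) ^ 2 ≤ ρ / c ^ 2 := by
  set E := ∑ e, (g (s e) - g (t e)) ^ 2 with hE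
  have hE0 : 0 ≤ E := Finset.sum_nonneg fun _ _ => sq_nonneg _
  have h1 : c * E ≤ g k - g l := by
    rw [← hg g, hE, Finset.mul_sum]
    refine Finset.sum_le_sum fun e _ => ?_
    rw [mul_assoc, ← sq]
    exact mul_le_mul_of_nonneg_right (hw e) (sq_nonneg _)
  -- The resistance inequality is applied to the representer itself; one factor E then cancels.
  have h2 : (c * E) ^ 2 ≤ ρ * E := (pow_le_pow_left₀ (by positivity) h1 2).trans (hρ g)
  rw [le_div_iff₀ (by positivity)]
  rcases hE0.eq_or_lt with h | h
  · rw [← h, zero_mul]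
    exact hρ0
  · exact le_of_mul_le_mul_right (by linarith [h2, show (c * E) ^ 2 = E * c ^ 2 * E by ring]) h

end Weighted

/-! ### The deterministic bound for the minimizer. -/

section Likelihood

variable {V ι : Type*} [Fintype ι] {L : ℕ}

/-- The negative log-likelihood for comparisons of `s e` with `t e`. -/
noncomputable def pairLoss (s t : ι → V) (y : ι → Fin L → ℝ) (θ : V → ℝ) : ℝ :=
  ∑ e, ∑ l : Fin L, (-(y e l) * (θ (s e) - θ (t e)) + Real.log (1 + Real.exp (θ (s e) - θ (t e))))

/-- The derivative of the summands of `pairLoss` with respect to the score difference. -/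
noncomputable def pairSlope (s t : ι → V) (y : ι → Fin L → ℝ) (θ : V → ℝ) (e : ι) : ℝ :=
  L * Real.sigmoid (θ (s e) - θ (t e)) - ∑ l, y e l

lemma sum_tangent (z : Fin L → ℝ) (a b c : ℝ) :
    ∑ l : Fin L, (-(z l) * a + c) + (L * Real.sigmoid a - ∑ l, z l) * (b - a) =
      ∑ l : Fin L, (-(z l) * b + (c + Real.sigmoid a * (b - a))) := by
  simp only [Finset.sum_add_distrib, ← Finset.sum_mul, Finset.sum_neg_distrib, Finset.sum_const,
    Finset.card_univ, Fintype.card_fin, nsmul_eq_mul]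
  ring

lemma pairLoss_tangent_lt (hL : 0 < L) (s t : ι → V) (y : ι → Fin L → ℝ) {θ θ' : V → ℝ}
    (h : ∃ e, θ (s e) - θ (t e) ≠ θ' (s e) - θ' (t e)) :
    pairLoss s t y θ +
        ∑ e, pairSlope s t y θ e * ((θ' (s e) - θ' (t e)) - (θ (s e) - θ (t e))) <
      pairLoss s t y θ' := by
  rw [pairLoss, pairLoss, ← Finset.sum_add_distrib]
  obtain ⟨e, he⟩ := h
  refine Finset.sum_lt_sum (fun e _ => ?_) ⟨e, Finset.mem_univ e, ?_⟩
  · rw [pairSlope, sum_tangent]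
    exact Finset.sum_le_sum fun l _ => by
      linarith [log_one_add_exp_tangent_le (θ (s e) - θ (t e)) (θ' (s e) - θ' (t e))]
  · rw [pairSlope, sum_tangent]
    exact Finset.sum_lt_sum_of_nonempty ⟨⟨0, hL⟩, Finset.mem_univ _⟩ fun l _ => by
      linarith [log_one_add_exp_tangent_lt he]

lemma pairLoss_le (s t : ι → V) (y : ι → Fin L → ℝ) (θ θ' : V → ℝ) :
    pairLoss s t y θ' ≤ pairLoss s t y θ +
        ∑ e, pairSlope s t y θ e * ((θ' (s e) - θ' (t e)) - (θ (s e) - θ (t e))) +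
        L * ∑ e, ((θ' (s e) - θ' (t e)) - (θ (s e) - θ (t e))) ^ 2 := by
  rw [pairLoss, pairLoss, ← Finset.sum_add_distrib, Finset.mul_sum, ← Finset.sum_add_distrib]
  refine Finset.sum_le_sum fun e _ => ?_
  rw [pairSlope, sum_tangent]
  calc _ ≤ ∑ l : Fin L, ((-(y e l) * (θ' (s e) - θ' (t e)) +
        (Real.log (1 + Real.exp (θ (s e) - θ (t e))) + Real.sigmoid (θ (s e) - θ (t e)) *
          (θ' (s e) - θ' (t e) - (θ (s e) - θ (t e))))) +
        ((θ' (s e) - θ' (t e)) - (θ (s e) - θ (t e))) ^ 2) :=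
        Finset.sum_le_sum fun l _ => by
          linarith [log_one_add_exp_le (θ (s e) - θ (t e)) (θ' (s e) - θ' (t e))]
    _ = _ := by
      rw [Finset.sum_add_distrib]
      simp

lemma continuous_pairLoss (s t : ι → V) (y : ι → Fin L → ℝ) : Continuous (pairLoss s t y) := by
  unfold pairLoss
  refine continuous_finsetSum _ fun e _ => continuous_finsetSum _ fun l _ => ?_
  refine Continuous.add (by fun_prop) (Continuous.log (by fun_prop) fun x => ?_)
  have := Real.exp_pos (x (s e) - x (t e))
  linarith

/-- If a functional `∑ e, f e * (v (s e) - v (t e))` has small coefficients, its representer varies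
little between the endpoints of a low-resistance pair. -/
lemma sq_representer_sub_le (s t : ι → V) {w f : ι → ℝ} {c ρ M : ℝ} (hc : 0 < c) (hρ0 : 0 ≤ ρ)
    (hw : ∀ e, c ≤ w e) {k l : V} {g q : V → ℝ}
    (hg : ∀ v, laplacianForm s t w g v = v k - v l)
    (hρ : ∀ x : V → ℝ, (x k - x l) ^ 2 ≤ ρ * ∑ e, (x (s e) - x (t e)) ^ 2)
    (hf : ∀ e, |f e| ≤ M)
    (hq : ∀ v, laplacianForm s t w q v = ∑ e, f e * (v (s e) - v (t e))) :
    (q k - q l) ^ 2 ≤ Fintype.card ι * M ^ 2 * (ρ / c ^ 2) := by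
  -- Reciprocity: the difference of `q` across (k, l) equals the functional `f` evaluated at the
  -- representer `g` of that pair.
  rw [← hg q, laplacianForm_comm, hq]
  refine (Finset.sum_mul_sq_le_sq_mul_sq _ _ _).trans ?_
  have h1 := sum_sq_representer_le s t hc hρ0 hw hg hρ
  have h2 : ∑ e, f e ^ 2 ≤ Fintype.card ι * M ^ 2 := by
    calc _ ≤ ∑ _e : ι, M ^ 2 := Finset.sum_le_sum fun e _ => by
          rw [← sq_abs]
          exact pow_le_pow_left₀ (abs_nonneg _) (hf e) 2
      _ = _ := by simp
  exact mul_le_mul h2 h1 (Finset.sum_nonneg fun _ _ => sq_nonneg _) (by positivity)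

lemma abs_le_of_sum_eq_zero [Fintype V] {x : V → ℝ} {M : ℝ} (hx : ∑ i, x i = 0)
    (h : ∀ k l, |x k - x l| ≤ M) (k : V) : |x k| ≤ M := by
  have hV : (0 : ℝ) < Fintype.card V := by
    exact_mod_cast Fintype.card_pos_iff.2 ⟨k⟩
  have h1 : (Fintype.card V : ℝ) * x k = ∑ l, (x k - x l) := by
    rw [Finset.sum_sub_distrib, hx]; simp
  have h2 : (Fintype.card V : ℝ) * |x k| ≤ Fintype.card V * M := by
    rw [← abs_of_pos hV, ← abs_mul, abs_of_pos hV, h1]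
    calc _ ≤ ∑ l, |x k - x l| := Finset.abs_sum_le_sum_abs _ _
      _ ≤ ∑ _l : V, M := Finset.sum_le_sum fun l _ => h k l
      _ = _ := by simp
  exact le_of_mul_le_mul_left h2 hV

/-- Deterministic error bound: when the representer `p` of the noise has small differences, the
likelihood has a strict minimizer close to the truth. -/
theorem exists_strict_minimizer [Fintype V] [Nonempty V] (hL : 0 < L) (s t : ι → V)
    (y : ι → Fin L → ℝ)
    {θs p : V → ℝ} {κ T R : ℝ} {ρ : V → V → ℝ} (hκ : 1 ≤ κ) (hT : 0 ≤ T) (hR : 0 ≤ R)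
    (hρ0 : ∀ k l, 0 ≤ ρ k l)
    (hsum : ∑ i, θs i = 0) (hstar : ∀ e, |θs (s e) - θs (t e)| ≤ Real.log κ)
    (hρ : ∀ k l (x : V → ℝ), (x k - x l) ^ 2 ≤ ρ k l * ∑ e, (x (s e) - x (t e)) ^ 2)
    (hρR : ∀ e, ρ (s e) (t e) ≤ R)
    (hp : ∀ v, laplacianForm s t (fun e => L * (Real.sigmoid (θs (s e) - θs (t e)) *
      (1 - Real.sigmoid (θs (s e) - θs (t e))))) p v =
      ∑ e, (-pairSlope s t y θs e) * (v (s e) - v (t e)))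
    (hnoise : ∀ k l, |p k - p l| ≤ 4 * κ * √(ρ k l * T))
    (hsmall : 4096 * κ ^ 4 * R ^ 2 * Fintype.card ι * T ≤ 1) (hpsum : ∑ i, p i = 0) :
    ∃ θ : V → ℝ, ∑ i, θ i = 0 ∧
      (∀ θ' : V → ℝ, ∑ i, θ' i = 0 → θ' ≠ θ → pairLoss s t y θ < pairLoss s t y θ') ∧
      ∀ k l, |(θ k - θ l) - (θs k - θs l)| ≤ 8 * κ * √(ρ k l * T) := by
  set w : ι → ℝ := fun e => L * (Real.sigmoid (θs (s e) - θs (t e)) *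
      (1 - Real.sigmoid (θs (s e) - θs (t e)))) with hwdef
  have hL' : (0 : ℝ) < L := by exact_mod_cast hL
  have hκ0 : 0 < κ := by linarith
  set c : ℝ := L * (1 / (4 * κ)) with hcdef
  have hc : 0 < c := by positivity
  have hw : ∀ e, c ≤ w e := fun e =>
    mul_le_mul_of_nonneg_left (inv_four_mul_le_sigmoid_deriv hκ (hstar e)) hL'.le
  have hw0 : ∀ e, 0 < w e := fun e => hc.trans_le (hw e)
  have hconn : ∀ x : V → ℝ, (∀ e, x (s e) = x (t e)) → ∀ k l, x k = x l := by
    intro x hx k l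
    have := hρ k l x
    simp only [hx, sub_self] at this
    have h0 : (x k - x l) ^ 2 = 0 := le_antisymm (by simpa using this) (sq_nonneg _)
    exact sub_eq_zero.1 (pow_eq_zero_iff two_ne_zero |>.1 h0)
  have hzero : ∀ x : V → ℝ, ∑ i, x i = 0 → (∀ e, x (s e) = x (t e)) → x = 0 := by
    intro x hx he
    funext k
    have := abs_le_of_sum_eq_zero (M := 0) hx (fun k l => by simp [hconn x he k l]) k
    simpa using this
  choose g _ hg using fun k l : V => exists_laplacianForm_eq s t hw0 hconn
    (LinearMap.proj (R := ℝ) (φ := fun _ : V => ℝ) k - LinearMap.proj l) (by simp)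
  replace hg : ∀ k l v, laplacianForm s t w (g k l) v = v k - v l := fun k l v => hg k l v
  -- The largest edge difference allowed for `p`, and also the one that will be proved for `q`;
  -- hence the radius 2η in `S`.
  set η : ℝ := 4 * κ * √(R * T) with hη
  have hη0 : 0 ≤ η := by positivity
  have hη2 : η ^ 2 = 16 * κ ^ 2 * R * T := by
    rw [hη, mul_pow, Real.sq_sqrt (by positivity)]; ring
  let S : Set (V → ℝ) := {θ | ∑ i, θ i = 0 ∧
    ∀ e, |(θ (s e) - θ (t e)) - (θs (s e) - θs (t e))| ≤ 2 * η}
  have hSclosed : IsClosed S := by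
    refine IsClosed.and (isClosed_eq (by fun_prop) (by fun_prop)) ?_
    simp only [Set.ofPred_forall]
    exact isClosed_iInter fun e => isClosed_le (by fun_prop) (by fun_prop)
  have hScompact : IsCompact S := by
    refine Metric.isCompact_of_isClosed_isBounded hSclosed ?_
    let N : ℝ := ∑ k, ∑ l, √(ρ k l * (Fintype.card ι * (2 * η) ^ 2))
    -- Finite resistances turn edge bounds into bounds for all differences, and the zero sum turns
    -- those into bounds for the entries.
    refine Metric.isBounded_closedBall (x := θs) (r := N) |>.subset fun θ hθ => ?_
    have hN : 0 ≤ N := by positivity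
    rw [Metric.mem_closedBall, dist_pi_le_iff hN]
    refine abs_le_of_sum_eq_zero (x := θ - θs) (by simp [hθ.1, hsum]) fun k l => ?_
    calc _ ≤ √(ρ k l * (Fintype.card ι * (2 * η) ^ 2)) := by
          refine Real.abs_le_sqrt ((hρ k l (θ - θs)).trans ?_)
          refine mul_le_mul_of_nonneg_left ?_ (hρ0 k l)
          calc _ ≤ ∑ _e : ι, (2 * η) ^ 2 := Finset.sum_le_sum fun e _ => by
                rw [← sq_abs]
                refine pow_le_pow_left₀ (abs_nonneg _) ?_ 2
                have h := hθ.2 e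
                rwa [show (θ (s e) - θ (t e)) - (θs (s e) - θs (t e)) =
                  (θ - θs) (s e) - (θ - θs) (t e) by simp only [Pi.sub_apply]; ring] at h
            _ = _ := by simp
      _ ≤ ∑ l, √(ρ k l * (Fintype.card ι * (2 * η) ^ 2)) :=
          Finset.single_le_sum (f := fun l => √(ρ k l * (Fintype.card ι * (2 * η) ^ 2)))
            (fun _ _ => Real.sqrt_nonneg _) (Finset.mem_univ l)
      _ ≤ N := Finset.single_le_sum
            (f := fun k => ∑ l, √(ρ k l * (Fintype.card ι * (2 * η) ^ 2)))
            (fun _ _ => Finset.sum_nonneg fun _ _ => Real.sqrt_nonneg _) (Finset.mem_univ k)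
  have hSne : S.Nonempty := ⟨θs, hsum, fun e => by simpa using hη0⟩
  obtain ⟨θ, hθS, hθmin⟩ := hScompact.exists_isMinOn hSne (continuous_pairLoss s t y).continuousOn
  set rem : ι → ℝ := fun e => L * (Real.sigmoid (θ (s e) - θ (t e)) -
    Real.sigmoid (θs (s e) - θs (t e))) -
    w e * ((θ (s e) - θ (t e)) - (θs (s e) - θs (t e))) with hrem
  have hremle : ∀ e, |rem e| ≤ L * (4 * η ^ 2) := by
    intro e
    have h := abs_sigmoid_taylor_le (θs (s e) - θs (t e))
      ((θ (s e) - θ (t e)) - (θs (s e) - θs (t e)))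
    rw [add_sub_cancel] at h
    have h2 : ((θ (s e) - θ (t e)) - (θs (s e) - θs (t e))) ^ 2 ≤ 4 * η ^ 2 := by
      rw [← sq_abs]
      calc _ ≤ (2 * η) ^ 2 := pow_le_pow_left₀ (abs_nonneg _) (hθS.2 e) 2
        _ = _ := by ring
    have h3 : rem e = L * (Real.sigmoid (θ (s e) - θ (t e)) - Real.sigmoid (θs (s e) - θs (t e)) -
        Real.sigmoid (θs (s e) - θs (t e)) * (1 - Real.sigmoid (θs (s e) - θs (t e))) *
          ((θ (s e) - θ (t e)) - (θs (s e) - θs (t e)))) := by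
      simp only [hrem, hwdef]
      ring
    rw [h3, abs_mul, abs_of_pos hL']
    exact mul_le_mul_of_nonneg_left (h.trans h2) hL'.le
  obtain ⟨q, hqsum, hq⟩ := exists_laplacianForm_eq s t hw0 hconn
    (∑ e, rem e • (LinearMap.proj (R := ℝ) (φ := fun _ : V => ℝ) (s e) - LinearMap.proj (t e)))
    (by simp)
  replace hq : ∀ v, laplacianForm s t w q v = ∑ e, rem e * (v (s e) - v (t e)) := by
    intro v; rw [hq]; simp
  have hqle : ∀ k l, |q k - q l| ≤ 4 * κ * √(ρ k l * T) := by
    intro k l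
    have hρkl := hρ0 k l
    have h1 := sq_representer_sub_le s t hc (hρ0 k l) hw (hg k l) (hρ k l) hremle hq
    have h2 : (q k - q l) ^ 2 ≤ 16 * κ ^ 2 * (ρ k l * T) := by
      refine h1.trans ?_
      -- The remainder is quadratic in η, which leaves exactly one extra factor, controlled by
      -- `hsmall`.
      calc _ = 16 * κ ^ 2 * (ρ k l * T) * (4096 * κ ^ 4 * R ^ 2 * Fintype.card ι * T) := by
            rw [mul_pow, mul_pow, hη2, hcdef]
            field_simp
            ring
        _ ≤ 16 * κ ^ 2 * (ρ k l * T) * 1 := by gcongr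
        _ = _ := mul_one _
    calc _ ≤ √(16 * κ ^ 2 * (ρ k l * T)) := Real.abs_le_sqrt h2
      _ = 4 * κ * √(ρ k l * T) := by
        rw [Real.sqrt_mul (by positivity), show 16 * κ ^ 2 = (4 * κ) ^ 2 by ring,
          Real.sqrt_sq (by positivity)]
  have hpq : ∀ k l, |(p k - p l) - (q k - q l)| ≤ 8 * κ * √(ρ k l * T) := fun k l => by
    calc _ ≤ |p k - p l| + |q k - q l| := abs_sub _ _
      _ ≤ _ := by linarith [hnoise k l, hqle k l]
  -- the slope at `θ` is minus the Laplacian form of the preconditioned step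
  have hslope : ∀ v : V → ℝ, ∑ e, pairSlope s t y θ e * (v (s e) - v (t e)) =
      laplacianForm s t w ((θ - θs) - (p - q)) v := by
    intro v
    rw [laplacianForm_sub_left, laplacianForm_sub_left _ _ _ p q, hp, hq, laplacianForm,
      ← Finset.sum_sub_distrib, ← Finset.sum_sub_distrib]
    refine Finset.sum_congr rfl fun e _ => ?_
    simp only [pairSlope, hrem, Pi.sub_apply]
    ring
  -- The step from `θ` to the target θ* + p - q. Here `q` depends on `θ`, but only its size is
  -- needed to keep the segment inside `S`.
  set u : V → ℝ := (p - q) - (θ - θs) with hu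
  have hstep : ∀ τ : ℝ, 0 ≤ τ → τ ≤ 1 → θ + τ • u ∈ S := by
    intro τ h0 h1
    constructor
    · simp [hu, Finset.sum_add_distrib, ← Finset.mul_sum, Finset.sum_sub_distrib, hθS.1, hpsum,
        hqsum, hsum]
    · intro e
      have h2 := hθS.2 e
      have h3 : |(p (s e) - p (t e)) - (q (s e) - q (t e))| ≤ 2 * η := by
        refine (hpq _ _).trans ?_
        calc _ ≤ 8 * κ * √(R * T) := by gcongr; exact hρR e
          _ = _ := by rw [hη]; ring
      calc _ = |(1 - τ) * ((θ (s e) - θ (t e)) - (θs (s e) - θs (t e))) +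
            τ * ((p (s e) - p (t e)) - (q (s e) - q (t e)))| := by
            congr 1
            simp [hu]
            ring
        _ ≤ (1 - τ) * (2 * η) + τ * (2 * η) := by
            refine (abs_add_le _ _).trans ?_
            rw [abs_mul, abs_mul, abs_of_nonneg h0, abs_of_nonneg (by linarith : 0 ≤ 1 - τ)]
            gcongr
        _ = _ := by ring
  set Q : ℝ := L * ∑ e, (u (s e) - u (t e)) ^ 2 with hQ
  have hdir : ∑ e, pairSlope s t y θ e * (u (s e) - u (t e)) = - laplacianForm s t w u u := by
    rw [hslope, show (θ - θs) - (p - q) = 0 - u by rw [hu]; abel, laplacianForm_sub_left]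
    simp [laplacianForm]
  -- Along the segment the loss changes by at most -τ times the H-energy of `u`, plus τ² Q;
  -- minimality and τ → 0 make that energy nonpositive.
  have hfirst : ∀ τ : ℝ, 0 < τ → τ ≤ 1 → laplacianForm s t w u u ≤ τ * Q := by
    intro τ h0 h1
    have h2 := hθmin (hstep τ h0.le h1)
    have h3 := pairLoss_le s t y θ (θ + τ • u)
    have h4 : ∀ e, ((θ + τ • u) (s e) - (θ + τ • u) (t e)) - (θ (s e) - θ (t e)) =
        τ * (u (s e) - u (t e)) := fun e => by simp; ring
    have h5 : ∑ e, pairSlope s t y θ e * (τ * (u (s e) - u (t e))) =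
        - τ * laplacianForm s t w u u := by
      rw [neg_mul, ← mul_neg, ← hdir, Finset.mul_sum]
      exact Finset.sum_congr rfl fun _ _ => by ring
    have h6 : L * ∑ e, (τ * (u (s e) - u (t e))) ^ 2 = τ ^ 2 * Q := by
      rw [hQ]
      simp only [mul_pow, ← Finset.mul_sum]
      ring
    simp only [h4, h5, h6] at h3
    simp only [Set.mem_ofPred_eq] at h2
    have h7 : τ * laplacianForm s t w u u ≤ τ * (τ * Q) := by nlinarith
    exact le_of_mul_le_mul_left h7 h0
  have hQ0 : 0 ≤ Q := by
    have : 0 ≤ ∑ e, (u (s e) - u (t e)) ^ 2 := Finset.sum_nonneg fun _ _ => sq_nonneg _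
    positivity
  have hH : laplacianForm s t w u u ≤ 0 := by
    refine le_of_forall_pos_le_add fun ε hε => ?_
    have h1 : 0 < Q + ε + 1 := by positivity
    have := hfirst (ε / (Q + ε + 1)) (by positivity) (by rw [div_le_one h1]; linarith)
    refine this.trans ?_
    rw [zero_add, div_mul_eq_mul_div, div_le_iff₀ h1]
    nlinarith
  have hu0 : u = 0 := by
    apply hzero
    · simp [hu, Finset.sum_sub_distrib, hθS.1, hpsum, hqsum, hsum]
    · have h1 : ∀ e ∈ Finset.univ, 0 ≤ w e * (u (s e) - u (t e)) * (u (s e) - u (t e)) :=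
        fun e _ => by
          rw [mul_assoc]
          exact mul_nonneg (hw0 e).le (mul_self_nonneg _)
      have h2 := (Finset.sum_eq_zero_iff_of_nonneg h1).1
        (le_antisymm hH (Finset.sum_nonneg h1))
      intro e
      have h3 := h2 e (Finset.mem_univ e)
      rw [mul_assoc] at h3
      exact sub_eq_zero.1 (mul_self_eq_zero.1 ((mul_eq_zero.1 h3).resolve_left (hw0 e).ne'))
  have hgrad : ∀ v : V → ℝ, ∑ e, pairSlope s t y θ e * (v (s e) - v (t e)) = 0 := by
    intro v
    rw [hslope, show (θ - θs) - (p - q) = 0 - u by rw [hu]; abel, hu0]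
    simp [laplacianForm]
  refine ⟨θ, hθS.1, fun θ' hθ' hne => ?_, fun k l => ?_⟩
  · have h1 : ∃ e, θ (s e) - θ (t e) ≠ θ' (s e) - θ' (t e) := by
      by_contra hcon
      push Not at hcon
      refine hne (sub_eq_zero.1 (hzero (θ' - θ) ?_ fun e => ?_))
      · simp [Finset.sum_sub_distrib, hθ', hθS.1]
      · have := hcon e
        simp only [Pi.sub_apply]
        linarith
    have h2 := pairLoss_tangent_lt hL s t y h1
    have h3 : ∑ e, pairSlope s t y θ e * ((θ' (s e) - θ' (t e)) - (θ (s e) - θ (t e))) = 0 := by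
      rw [← hgrad (θ' - θ)]
      exact Finset.sum_congr rfl fun e _ => by simp only [Pi.sub_apply]; ring
    linarith
  · have h1 : (θ k - θ l) - (θs k - θs l) = (p k - p l) - (q k - q l) := by
      have hk := congrFun hu0 k
      have hl := congrFun hu0 l
      simp only [hu, Pi.sub_apply, Pi.zero_apply] at hk hl
      linarith
    rw [h1]
    exact hpq k l

end Likelihood

/-! ### Concentration of the noise. -/

section Noise

open scoped NNReal

lemma hasSubgaussianMGF_mono {Ω : Type*} [MeasurableSpace Ω] {P : Measure Ω} {X : Ω → ℝ}
    {c c' : ℝ≥0} (h : HasSubgaussianMGF X c P) (hc : c ≤ c') : HasSubgaussianMGF X c' P where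
  integrable_exp_mul := h.integrable_exp_mul
  mgf_le t := (h.mgf_le t).trans (Real.exp_le_exp.2 (by
    have : (c : ℝ) ≤ c' := hc
    gcongr))

/-- A Bernoulli variable minus its success probability is sub-Gaussian with parameter `1 / 4`. -/
lemma hasSubgaussianMGF_bernoulli {Ω : Type*} [MeasurableSpace Ω] {P : Measure Ω}
    [IsProbabilityMeasure P] {Y : Ω → ℝ} (hY : Measurable Y) {p : ℝ} (hp0 : 0 ≤ p) (hp1 : p ≤ 1)
    (h1 : P {ω | Y ω = 1} = ENNReal.ofReal p) (h0 : P {ω | Y ω = 0} = ENNReal.ofReal (1 - p)) :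
    HasSubgaussianMGF (fun ω => Y ω - p) (1 / 4) P := by
  have hm1 : MeasurableSet {ω | Y ω = 1} := hY (measurableSet_singleton 1)
  have hm0 : MeasurableSet {ω | Y ω = 0} := hY (measurableSet_singleton 0)
  have hdisj : Disjoint {ω | Y ω = 1} {ω | Y ω = 0} := by
    rw [Set.disjoint_left]
    intro ω h h'
    simp only [Set.mem_ofPred_eq] at h h'
    rw [h] at h'
    exact one_ne_zero h'
  have hae : ∀ᵐ ω ∂P, ω ∈ {ω | Y ω = 1} ∪ {ω | Y ω = 0} := by
    refine (mem_ae_iff_prob_eq_one (hm1.union hm0)).2 ?_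
    rw [measure_union hdisj hm0, h1, h0,
      ← ENNReal.ofReal_add hp0 (by linarith)]
    simp
  have hint : ∫ ω, Y ω ∂P = p := by
    have : Y =ᵐ[P] Set.indicator {ω | Y ω = 1} (fun _ => (1 : ℝ)) := by
      filter_upwards [hae] with ω hω
      rcases hω with h | h
      · rw [Set.indicator_of_mem h]; exact h
      · rw [Set.indicator_of_notMem (fun h' => hdisj.le_bot ⟨h', h⟩)]; exact h
    rw [integral_congr_ae this, integral_indicator hm1]
    simp [Measure.real, h1, hp0]
  have := hasSubgaussianMGF_of_mem_Icc (a := 0) (b := 1) hY.aemeasurable (μ := P) (by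
    filter_upwards [hae] with ω hω
    rcases hω with h | h <;> simp only [Set.mem_ofPred_eq] at h <;> simp [h])
  rw [hint] at this
  convert this using 1
  simp
  norm_num

/-- **Hoeffding's inequality** for weighted sums of independent centred Bernoulli variables. -/
lemma measureReal_weighted_bernoulli_ge_le {Ω ι : Type*} [Fintype ι] [MeasurableSpace Ω]
    {P : Measure Ω} [IsProbabilityMeasure P] {Y : ι → Ω → ℝ} (hY : ∀ i, Measurable (Y i))
    {p c : ι → ℝ} (hp0 : ∀ i, 0 ≤ p i) (hp1 : ∀ i, p i ≤ 1)
    (h1 : ∀ i, P {ω | Y i ω = 1} = ENNReal.ofReal (p i))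
    (h0 : ∀ i, P {ω | Y i ω = 0} = ENNReal.ofReal (1 - p i)) (hind : iIndepFun Y P)
    {W ε : ℝ} (hW : ∑ i, c i ^ 2 / 4 ≤ W) (hε : 0 ≤ ε) :
    P.real {ω | ε ≤ ∑ i, c i * (Y i ω - p i)} ≤ Real.exp (-ε ^ 2 / (2 * W)) := by
  have hsub : ∀ i ∈ Finset.univ, HasSubgaussianMGF (fun ω => c i * (Y i ω - p i))
      (c i ^ 2 / 4).toNNReal P := fun i _ =>
    hasSubgaussianMGF_mono ((hasSubgaussianMGF_bernoulli (hY i) (hp0 i) (hp1 i) (h1 i)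
      (h0 i)).const_mul (c i)) (by
        refine NNReal.coe_le_coe.1 ?_
        rw [Real.coe_toNNReal _ (by positivity)]
        change c i ^ 2 * ((1 / 4 : ℝ≥0) : ℝ) ≤ _
        push_cast
        linarith)
  have hind' : iIndepFun (fun i ω => c i * (Y i ω - p i)) P :=
    hind.comp (fun i z => c i * (z - p i)) (fun i => by fun_prop)
  have hW0 : 0 ≤ W := (Finset.sum_nonneg fun i _ => by positivity).trans hW
  have h := hasSubgaussianMGF_mono (HasSubgaussianMGF.sum_of_iIndepFun hind' hsub)
    (c' := W.toNNReal) (by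
      rw [← Real.toNNReal_sum_of_nonneg fun i _ => by positivity]
      exact Real.toNNReal_le_toNNReal hW)
  have := h.measure_ge_le hε
  rwa [Real.coe_toNNReal _ hW0] at this

end Noise

/-! ### The error bound in terms of effective resistances. -/

section MLE

variable {V : Type*} [LinearOrder V] [Fintype V]

open scoped Classical in
/-- The Dirichlet energy of `x` on the graph `G`. -/
noncomputable def energy (G : SimpleGraph V) (x : V → ℝ) : ℝ :=
  ∑ e : OrientedEdge G, (x e.1.1 - x e.1.2) ^ 2

open scoped Classical in
/-- Error of the maximum likelihood estimate in terms of bounds `ρ k l` on effective resistances,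
`R` being a bound for the edges. -/
theorem mle_error_of_resistance_bound [Nonempty V] (G : SimpleGraph V) {L : ℕ} (hL : 0 < L)
    {θs : V → ℝ} {κ δ R : ℝ} {ρ : V → V → ℝ} (hκ : 1 ≤ κ) (hδ : 0 < δ) (hδ1 : δ < 1) (hR : 0 ≤ R)
    (hρ0 : ∀ k l, 0 < ρ k l) (hρsymm : ∀ k l, ρ k l = ρ l k)
    (hsum : ∑ i, θs i = 0) (hstar : ∀ i j, G.Adj i j → |θs i - θs j| ≤ Real.log κ)
    (hρ : ∀ k l (x : V → ℝ), (x k - x l) ^ 2 ≤ ρ k l * energy G x)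
    (hρR : ∀ i j, G.Adj i j → ρ i j ≤ R)
    (hcond : 4096 * κ ^ 4 * R ^ 2 * Fintype.card (OrientedEdge G) *
      Real.log (Fintype.card V / δ) ≤ L)
    {Ω : Type*} [MeasurableSpace Ω] (P : Measure Ω) [IsProbabilityMeasure P]
    {y : OrientedEdge G → Fin L → Ω → ℝ} (hy : IsSample P G L θs y) :
    ∃ A : Set Ω, MeasurableSet A ∧ ENNReal.ofReal (1 - δ) ≤ P A ∧ ∀ ω ∈ A,
      (∃! θ : V → ℝ, IsMLE G L (fun e l => y e l ω) θ) ∧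
      ∀ θ : V → ℝ, IsMLE G L (fun e l => y e l ω) θ →
        ∀ k l : V, |(θ k - θ l) - (θs k - θs l)| ≤
          8 * κ * √(ρ k l * (Real.log (Fintype.card V / δ) / L)) := by
  set s : OrientedEdge G → V := fun e => e.1.1 with hs
  set t : OrientedEdge G → V := fun e => e.1.2 with ht
  set n : ℝ := (Fintype.card V : ℝ) with hn
  have hn1 : 1 ≤ n := by
    rw [hn]; exact_mod_cast Fintype.card_pos
  have hL' : (0 : ℝ) < L := by exact_mod_cast hL
  have hκ0 : 0 < κ := by linarith
  set T : ℝ := Real.log (n / δ) / L with hTdef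
  have hlog : 0 < Real.log (n / δ) := Real.log_pos (by rw [lt_div_iff₀ hδ]; linarith)
  have hT : 0 < T := by positivity
  set σ : OrientedEdge G → ℝ := fun e => Real.sigmoid (θs (s e) - θs (t e)) with hσ
  set w : OrientedEdge G → ℝ := fun e => L * (Real.sigmoid (θs (s e) - θs (t e)) *
      (1 - Real.sigmoid (θs (s e) - θs (t e)))) with hwdef
  have hstar' : ∀ e, |θs (s e) - θs (t e)| ≤ Real.log κ := fun e => hstar _ _ e.2.1
  set c : ℝ := L * (1 / (4 * κ)) with hcdef
  have hc : 0 < c := by positivity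
  have hw : ∀ e, c ≤ w e := fun e =>
    mul_le_mul_of_nonneg_left (inv_four_mul_le_sigmoid_deriv hκ (hstar' e)) hL'.le
  have hw0 : ∀ e, 0 < w e := fun e => hc.trans_le (hw e)
  have hρ' : ∀ k l (x : V → ℝ), (x k - x l) ^ 2 ≤ ρ k l * ∑ e, (x (s e) - x (t e)) ^ 2 := hρ
  have hconn : ∀ x : V → ℝ, (∀ e, x (s e) = x (t e)) → ∀ k l, x k = x l := by
    intro x hx k l
    have := hρ' k l x
    simp only [hx, sub_self] at this
    have h0 : (x k - x l) ^ 2 = 0 := le_antisymm (by simpa using this) (sq_nonneg _)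
    exact sub_eq_zero.1 (pow_eq_zero_iff two_ne_zero |>.1 h0)
  choose g _ hg using fun k l : V => exists_laplacianForm_eq s t hw0 hconn
    (LinearMap.proj (R := ℝ) (φ := fun _ : V => ℝ) k - LinearMap.proj l) (by simp)
  replace hg : ∀ k l v, laplacianForm s t w (g k l) v = v k - v l := fun k l v => hg k l v
  let N : V → V → Ω → ℝ := fun k l ω => ∑ x : OrientedEdge G × Fin L,
    (g k l (s x.1) - g k l (t x.1)) * (y x.1 x.2 ω - σ x.1)
  have hNm : ∀ k l, Measurable (N k l) := fun k l =>
    Finset.measurable_sum _ fun x _ => ((hy.measurable x.1 x.2).sub_const _).const_mul _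
  let ε : V → V → ℝ := fun k l => 4 * κ * √(ρ k l * T)
  have htail : ∀ k l, P.real {ω | ε k l ≤ N k l ω} ≤ (δ / n) ^ 2 := by
    intro k l
    have hρkl := hρ0 k l
    -- The variance proxy is L (ρ/c²)/4 with c = L/(4κ). Then ε²/(2W) = 2 log(n/δ), which gives the
    -- tail (δ/n)².
    refine (measureReal_weighted_bernoulli_ge_le (W := 4 * κ ^ 2 * ρ k l / L)
      (fun x : OrientedEdge G × Fin L => hy.measurable x.1 x.2)
      (fun x => Real.sigmoid_nonneg _) (fun x => Real.sigmoid_le_one _)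
      (fun x => hy.prob_one x.1 x.2) (fun x => hy.prob_zero x.1 x.2) hy.indep ?_
      (by positivity)).trans (le_of_eq ?_)
    · have h1 := sum_sq_representer_le s t hc hρkl.le hw (hg k l) (hρ' k l)
      rw [Fintype.sum_prod_type]
      simp only [Finset.sum_const, Finset.card_univ, Fintype.card_fin, nsmul_eq_mul,
        ← Finset.mul_sum, ← Finset.sum_div]
      calc _ ≤ L * ((ρ k l / c ^ 2) / 4) := by gcongr
        _ = _ := by rw [hcdef]; field_simp
    · have h1 : -(ε k l) ^ 2 / (2 * (4 * κ ^ 2 * ρ k l / L)) = -(2 * Real.log (n / δ)) := by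
        simp only [ε]
        rw [mul_pow, Real.sq_sqrt (by positivity), hTdef]
        field_simp
        norm_num
      rw [h1, show -(2 * Real.log (n / δ)) = Real.log ((δ / n) ^ 2) by
        rw [Real.log_pow, ← inv_div n δ, Real.log_inv]
        push_cast
        ring]
      exact Real.exp_log (by positivity)
  refine ⟨⋂ k, ⋂ l, {ω | N k l ω < ε k l}, ?_, ?_, ?_⟩
  · exact MeasurableSet.iInter fun k => MeasurableSet.iInter fun l =>
      measurableSet_lt (hNm k l) measurable_const
  · have hmeas : MeasurableSet (⋂ k, ⋂ l, {ω | N k l ω < ε k l}) :=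
      MeasurableSet.iInter fun k => MeasurableSet.iInter fun l =>
        measurableSet_lt (hNm k l) measurable_const
    have hcompl : P.real (⋂ k, ⋂ l, {ω | N k l ω < ε k l})ᶜ ≤ δ := by
      have hsub : (⋂ k, ⋂ l, {ω | N k l ω < ε k l})ᶜ =
          ⋃ x ∈ (Finset.univ : Finset (V × V)), {ω | ε x.1 x.2 ≤ N x.1 x.2 ω} := by
        ext ω
        simp
      rw [hsub]
      refine (measureReal_biUnion_finset_le _ _).trans ?_
      -- A union over the n² ordered pairs; using both orders turns the one-sided tails into bounds
      -- for absolute values.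
      calc _ ≤ ∑ _x : V × V, (δ / n) ^ 2 := Finset.sum_le_sum fun x _ => htail _ _
        _ = δ ^ 2 := by
          simp only [Finset.sum_const, Finset.card_univ, Fintype.card_prod, nsmul_eq_mul]
          push_cast
          rw [← hn]
          field_simp
        _ ≤ δ := by nlinarith
    rw [measureReal_compl hmeas, probReal_univ] at hcompl
    rw [← ofReal_measureReal]
    exact ENNReal.ofReal_le_ofReal (by linarith)
  · intro ω hω
    have hωN : ∀ k l, N k l ω < ε k l := by simpa using hω
    set yω : OrientedEdge G → Fin L → ℝ := fun e l => y e l ω with hyω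
    obtain ⟨p, hpsum, hp⟩ := exists_laplacianForm_eq s t hw0 hconn
      (∑ e, (-pairSlope s t yω θs e) •
        (LinearMap.proj (R := ℝ) (φ := fun _ : V => ℝ) (s e) - LinearMap.proj (t e))) (by simp)
    replace hp : ∀ v, laplacianForm s t w p v =
        ∑ e, (-pairSlope s t yω θs e) * (v (s e) - v (t e)) := by
      intro v; rw [hp]; simp
    have hpN : ∀ k l, p k - p l = N k l ω := by
      intro k l
      rw [← hg k l p, laplacianForm_comm, hp]
      simp only [N]
      rw [Fintype.sum_prod_type]
      refine Finset.sum_congr rfl fun e _ => ?_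
      dsimp only
      rw [← Finset.mul_sum, Finset.sum_sub_distrib, pairSlope]
      simp only [Finset.sum_const, Finset.card_univ, Fintype.card_fin, nsmul_eq_mul, hσ, hyω]
      ring
    have hnoise : ∀ k l, |p k - p l| ≤ 4 * κ * √(ρ k l * T) := by
      intro k l
      have h1 := hωN k l
      have h2 := hωN l k
      rw [← hpN] at h1 h2
      simp only [ε] at h1 h2
      rw [hρsymm l k] at h2
      exact abs_le.2 ⟨by linarith, h1.le⟩
    have hsmall : 4096 * κ ^ 4 * R ^ 2 * Fintype.card (OrientedEdge G) * T ≤ 1 := by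
      rw [hTdef, ← mul_div_assoc, div_le_one hL']
      exact hcond
    obtain ⟨θ, hθ, hθmin, hθerr⟩ := exists_strict_minimizer hL s t yω hκ hT.le hR
      (fun k l => (hρ0 k l).le) hsum hstar' hρ' (fun e => hρR _ _ e.2.1) hp hnoise hsmall hpsum
    have hloss : ∀ θ', loss G L yω θ' = pairLoss s t yω θ' := fun θ' => rfl
    have hMLE : IsMLE G L yω θ := by
      refine ⟨hθ, fun θ' hθ' => ?_⟩
      rcases eq_or_ne θ' θ with rfl | hne
      · exact le_refl (loss G L yω θ')
      · exact (hθmin θ' hθ' hne).le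
    have huniq : ∀ θ', IsMLE G L yω θ' → θ' = θ := by
      intro θ' hθ'
      by_contra hne
      exact (hθmin θ' hθ'.1 hne).not_ge (hθ'.2 hθ)
    refine ⟨⟨θ, hMLE, huniq⟩, fun θ' hθ' => ?_⟩
    rw [huniq θ' hθ']
    exact hθerr

end MLE

/-! ### Jensen and Cauchy-Schwarz for averages and paths. -/

section Averages

lemma sum_comp_le_of_injOn {α β : Type*} {s : Finset α} {t : Finset β} {φ : α → β} {F : β → ℝ}
    (hφ : Set.InjOn φ s) (hst : ∀ a ∈ s, φ a ∈ t) (hF : ∀ b ∈ t, 0 ≤ F b) :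
    ∑ a ∈ s, F (φ a) ≤ ∑ b ∈ t, F b := by
  classical
  rw [← Finset.sum_image (f := F) hφ]
  exact Finset.sum_le_sum_of_subset_of_nonneg (Finset.image_subset_iff.2 hst) fun b hb _ => hF b hb

lemma sq_average_sub_le {α : Type*} {s : Finset α} (hs : s.Nonempty) (z : α → ℝ) (c : ℝ) :
    ((∑ i ∈ s, z i) / s.card - c) ^ 2 ≤ (∑ i ∈ s, (z i - c) ^ 2) / s.card := by
  have h0 : (0 : ℝ) < s.card := by exact_mod_cast hs.card_pos
  have h1 : (∑ i ∈ s, z i) / s.card - c = (∑ i ∈ s, (z i - c)) / s.card := by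
    rw [Finset.sum_sub_distrib, Finset.sum_const, nsmul_eq_mul]
    field_simp
  rw [h1, div_pow, div_le_div_iff₀ (by positivity) h0]
  nlinarith [sq_sum_le_card_mul_sum_sq (s := s) (f := fun i => z i - c)]

lemma sq_average_sub_le_of_forall {α : Type*} {s : Finset α} (hs : s.Nonempty) {z : α → ℝ}
    {c B : ℝ} (h : ∀ i ∈ s, (z i - c) ^ 2 ≤ B) : ((∑ i ∈ s, z i) / s.card - c) ^ 2 ≤ B := by
  have h0 : (0 : ℝ) < s.card := by exact_mod_cast hs.card_pos
  refine (sq_average_sub_le hs z c).trans ((div_le_iff₀ h0).2 ?_)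
  calc _ ≤ ∑ _i ∈ s, B := Finset.sum_le_sum h
    _ = _ := by rw [Finset.sum_const, nsmul_eq_mul, mul_comm]

lemma sq_average_sub_average_le {α β : Type*} {s : Finset α} {t : Finset β} (hs : s.Nonempty)
    (ht : t.Nonempty) (z : α → ℝ) (z' : β → ℝ) :
    ((∑ i ∈ s, z i) / s.card - (∑ j ∈ t, z' j) / t.card) ^ 2 ≤
      (∑ p ∈ s ×ˢ t, (z p.1 - z' p.2) ^ 2) / (s.card * t.card) := by
  have h0 : (0 : ℝ) < s.card := by exact_mod_cast hs.card_pos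
  have h1 : (0 : ℝ) < t.card := by exact_mod_cast ht.card_pos
  have h := sq_average_sub_le (hs.product ht) (fun p => z p.1 - z' p.2) 0
  rw [Finset.card_product, Finset.sum_product, Nat.cast_mul] at h
  simp only [sub_zero] at h
  convert h using 2
  simp only [Finset.sum_sub_distrib, Finset.sum_const, nsmul_eq_mul, ← Finset.mul_sum]
  field_simp

lemma sq_sub_le_path {Z : ℕ → ℝ} {K d a b : ℕ} (ha : a ≤ K) (hb : b ≤ K) (hab : a ≤ b + d)
    (hba : b ≤ a + d) : (Z a - Z b) ^ 2 ≤ d * ∑ i ∈ Finset.range K, (Z (i + 1) - Z i) ^ 2 := by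
  have key : ∀ a b : ℕ, b ≤ K → a ≤ b → b ≤ a + d →
      (Z b - Z a) ^ 2 ≤ d * ∑ i ∈ Finset.range K, (Z (i + 1) - Z i) ^ 2 := by
    intro a b hb hab hd
    obtain ⟨m, rfl⟩ := Nat.exists_eq_add_of_le hab
    have h1 : Z (a + m) - Z a = ∑ i ∈ Finset.range m, (Z (a + i + 1) - Z (a + i)) :=
      (Finset.sum_range_sub (fun i => Z (a + i)) m).symm
    have h2 : ∑ i ∈ Finset.range m, (Z (a + i + 1) - Z (a + i)) ^ 2 ≤
        ∑ i ∈ Finset.range K, (Z (i + 1) - Z i) ^ 2 :=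
      sum_comp_le_of_injOn (φ := fun i => a + i) (F := fun i => (Z (i + 1) - Z i) ^ 2)
        (fun _ _ _ _ h => Nat.add_left_cancel h)
        (fun i hi => Finset.mem_range.2 (by have := Finset.mem_range.1 hi; omega))
        (fun _ _ => sq_nonneg _)
    rw [h1]
    refine sq_sum_le_card_mul_sum_sq.trans ?_
    rw [Finset.card_range]
    have h3 : (m : ℝ) ≤ d := by exact_mod_cast (by omega : m ≤ d)
    have h4 : 0 ≤ ∑ i ∈ Finset.range m, (Z (a + i + 1) - Z (a + i)) ^ 2 :=
      Finset.sum_nonneg fun _ _ => sq_nonneg _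
    gcongr
  rcases le_total a b with h | h
  · rw [← neg_sq, neg_sub]
    exact key a b hb h hba
  · exact key b a ha h hab

end Averages

/-! ### Logarithmic resistance of the square lattice. -/

section Lattice

open Finset.HasAntidiagonal (antidiagonal)

/-- Averages over successive antidiagonals differ by little. -/
lemma sq_antidiagonal_average_step (Y : ℕ → ℕ → ℝ) (d : ℕ) :
    ((∑ p ∈ antidiagonal (d + 1), Y p.1 p.2) / ((d + 1 : ℕ) + 1) -
      (∑ p ∈ antidiagonal d, Y p.1 p.2) / (d + 1)) ^ 2 ≤
    2 / (d + 1) * ∑ p ∈ antidiagonal d,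
      ((Y (p.1 + 1) p.2 - Y p.1 p.2) ^ 2 + (Y p.1 (p.2 + 1) - Y p.1 p.2) ^ 2) := by
  set S := ∑ p ∈ antidiagonal d, Y p.1 p.2 with hS
  set S' := ∑ p ∈ antidiagonal (d + 1), Y p.1 p.2 with hS'
  -- A point of antidiagonal d + 1 is reached from the left with weight p.1 and from below with
  -- weight p.2, in total d + 1. This is the unit flow that passes from the uniform distribution on
  -- one antidiagonal to that on the next.
  have h1 : ∑ p ∈ antidiagonal d, ((p.1 + 1 : ℝ) * Y (p.1 + 1) p.2 +
      (p.2 + 1 : ℝ) * Y p.1 (p.2 + 1)) = (d + 1) * S' := by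
    have ha := Finset.Nat.sum_antidiagonal_succ (n := d) (f := fun p => (p.1 : ℝ) * Y p.1 p.2)
    have hb := Finset.Nat.sum_antidiagonal_succ' (n := d) (f := fun p => (p.2 : ℝ) * Y p.1 p.2)
    simp only [Nat.cast_zero, zero_mul, zero_add, Nat.cast_add, Nat.cast_one] at ha hb
    rw [Finset.sum_add_distrib, ← ha, ← hb, ← Finset.sum_add_distrib, hS', Finset.mul_sum]
    refine Finset.sum_congr rfl fun p hp => ?_
    have : (p.1 : ℝ) + p.2 = d + 1 := by
      exact_mod_cast Finset.HasAntidiagonal.mem_antidiagonal.1 hp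
    rw [← this]; ring
  have h2 : ∑ p ∈ antidiagonal d, ((p.1 + 1 : ℝ) * Y p.1 p.2 +
      (p.2 + 1 : ℝ) * Y p.1 p.2) = (d + 2) * S := by
    rw [hS, Finset.mul_sum]
    refine Finset.sum_congr rfl fun p hp => ?_
    have : (p.1 : ℝ) + p.2 = d := by
      exact_mod_cast Finset.HasAntidiagonal.mem_antidiagonal.1 hp
    rw [← this]; ring
  have h3 : S' / ((d + 1 : ℕ) + 1) - S / (d + 1) = ∑ p ∈ antidiagonal d,
      ((p.1 + 1 : ℝ) / (d + 2) * (Y (p.1 + 1) p.2 - Y p.1 p.2) +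
        (p.2 + 1 : ℝ) / (d + 2) * (Y p.1 (p.2 + 1) - Y p.1 p.2)) / (d + 1) := by
    calc _ = ((d + 1) * S' - (d + 2) * S) / ((d + 2) * (d + 1)) := by
          push_cast
          field_simp
          ring
      _ = _ := by
          rw [← h1, ← h2, ← Finset.sum_sub_distrib, Finset.sum_div]
          refine Finset.sum_congr rfl fun p _ => ?_
          field_simp
          ring
  rw [h3]
  -- Each edge carries flow at most 1/(d + 1), and the layer has 2(d + 1) edges.
  have h4 : (2 : ℝ) / (d + 1) = ∑ _p ∈ antidiagonal d, (2 : ℝ) / (d + 1) ^ 2 := by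
    rw [Finset.sum_const, Finset.Nat.card_antidiagonal, nsmul_eq_mul]
    push_cast
    field_simp
  rw [h4]
  refine Finset.sum_sq_le_sum_mul_sum_of_sq_le_mul _ (fun _ _ => by positivity)
    (fun _ _ => by positivity) fun p hp => ?_
  have hp' : (p.1 : ℝ) + p.2 = d := by
    exact_mod_cast Finset.HasAntidiagonal.mem_antidiagonal.1 hp
  have hp1 : (0 : ℝ) ≤ p.1 := Nat.cast_nonneg _
  have hp2 : (0 : ℝ) ≤ p.2 := Nat.cast_nonneg _
  have hα : ((p.1 + 1 : ℝ) / (d + 2)) ^ 2 ≤ 1 :=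
    pow_le_one₀ (by positivity) ((div_le_one (by positivity)).2 (by linarith))
  have hβ : ((p.2 + 1 : ℝ) / (d + 2)) ^ 2 ≤ 1 :=
    pow_le_one₀ (by positivity) ((div_le_one (by positivity)).2 (by linarith))
  rw [div_pow, div_mul_eq_mul_div (2 : ℝ)]
  gcongr
  refine (add_sq_le).trans ?_
  rw [mul_pow, mul_pow]
  gcongr
  · exact mul_le_of_le_one_left (sq_nonneg _) hα
  · exact mul_le_of_le_one_left (sq_nonneg _) hβ

lemma sum_two_div_le (D : ℕ) :
    ∑ d ∈ Finset.range D, (2 : ℝ) / (d + 1) ≤ 2 * (1 + Real.log D) := by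
  have h := harmonic_le_one_add_log D
  rw [harmonic] at h
  push_cast at h
  calc _ = 2 * ∑ d ∈ Finset.range D, ((d : ℝ) + 1)⁻¹ := by
        rw [Finset.mul_sum]; rfl
    _ ≤ _ := by gcongr

/-- Telescoping over the layers and Cauchy-Schwarz: the layer resistances 2/(d + 1) add up to a
harmonic sum, which is the source of the logarithm. -/
lemma sq_corner_sub_antidiagonal_average_le (Y : ℕ → ℕ → ℝ) (D : ℕ) :
    ((∑ p ∈ antidiagonal D, Y p.1 p.2) / (D + 1) - Y 0 0) ^ 2 ≤
      2 * (1 + Real.log D) * ∑ d ∈ Finset.range D, ∑ p ∈ antidiagonal d,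
        ((Y (p.1 + 1) p.2 - Y p.1 p.2) ^ 2 + (Y p.1 (p.2 + 1) - Y p.1 p.2) ^ 2) := by
  have h := Finset.sum_range_sub
    (fun d : ℕ => (∑ p ∈ antidiagonal d, Y p.1 p.2) / ((d : ℝ) + 1)) D
  simp only [Finset.Nat.antidiagonal_zero, Finset.sum_singleton, Nat.cast_zero, zero_add,
    div_one] at h
  rw [← h]
  refine (Finset.sum_sq_le_sum_mul_sum_of_sq_le_mul _ (fun d _ => by positivity)
    (fun _ _ => Finset.sum_nonneg fun _ _ => by positivity)
    (fun d _ => sq_antidiagonal_average_step Y d)).trans ?_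
  exact mul_le_mul_of_nonneg_right (sum_two_div_le D)
    (Finset.sum_nonneg fun _ _ => Finset.sum_nonneg fun _ _ => by positivity)

/-- From any point of `{0, …, K}` one can walk `K / 2` steps in one direction. -/
lemma exists_straight_walk {K k : ℕ} (hk : k ≤ K) :
    ∃ f e : ℕ → ℕ, f 0 = k ∧ (∀ i ≤ K / 2, f i ≤ K) ∧ Set.InjOn f {i | i ≤ K / 2} ∧
      (∀ i < K / 2, e i < K) ∧ Set.InjOn e {i | i < K / 2} ∧
      ∀ i < K / 2, ∀ Z : ℕ → ℝ, (Z (f (i + 1)) - Z (f i)) ^ 2 = (Z (e i + 1) - Z (e i)) ^ 2 := by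
  by_cases h : k + K / 2 ≤ K
  · refine ⟨fun i => k + i, fun i => k + i, rfl, fun i hi => by dsimp only; omega, ?_, fun i hi => by dsimp only; omega, ?_,
      fun i hi Z => rfl⟩
    · intro i _ j _ hij
      simpa using hij
    · intro i _ j _ hij
      simpa using hij
  · refine ⟨fun i => k - i, fun i => k - i - 1, rfl, fun i hi => by dsimp only; omega, ?_,
      fun i hi => by dsimp only; omega, ?_, fun i hi Z => ?_⟩
    · intro i hi j hj hij
      simp only [Set.mem_ofPred_eq] at hi hj hij
      omega
    · intro i hi j hj hij
      simp only [Set.mem_ofPred_eq] at hi hj hij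
      omega
    · have h1 : k - (i + 1) = k - i - 1 := by omega
      have h2 : k - i - 1 + 1 = k - i := by omega
      simp only [h1, h2]
      ring

/-- The energy of the horizontal edges of the square lattice `{0, …, K}²`. -/
def horizontalEnergy (K : ℕ) (X : ℕ → ℕ → ℝ) : ℝ :=
  ∑ p ∈ Finset.range K ×ˢ Finset.range (K + 1), (X (p.1 + 1) p.2 - X p.1 p.2) ^ 2

/-- The energy of the vertical edges of the square lattice `{0, …, K}²`. -/
def verticalEnergy (K : ℕ) (X : ℕ → ℕ → ℝ) : ℝ :=
  ∑ p ∈ Finset.range (K + 1) ×ˢ Finset.range K, (X p.1 (p.2 + 1) - X p.1 p.2) ^ 2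

lemma horizontalEnergy_nonneg (K : ℕ) (X : ℕ → ℕ → ℝ) : 0 ≤ horizontalEnergy K X :=
  Finset.sum_nonneg fun _ _ => sq_nonneg _

lemma verticalEnergy_nonneg (K : ℕ) (X : ℕ → ℕ → ℝ) : 0 ≤ verticalEnergy K X :=
  Finset.sum_nonneg fun _ _ => sq_nonneg _

lemma row_energy_le {K j : ℕ} (X : ℕ → ℕ → ℝ) (hj : j ≤ K) :
    ∑ i ∈ Finset.range K, (X (i + 1) j - X i j) ^ 2 ≤ horizontalEnergy K X :=
  sum_comp_le_of_injOn (φ := fun i => (i, j))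
    (F := fun p : ℕ × ℕ => (X (p.1 + 1) p.2 - X p.1 p.2) ^ 2)
    (fun _ _ _ _ h => (Prod.mk.inj h).1)
    (fun i hi => by simp only [Finset.mem_product, Finset.mem_range] at *; omega)
    (fun _ _ => sq_nonneg _)

lemma column_energy_le {K i : ℕ} (X : ℕ → ℕ → ℝ) (hi : i ≤ K) :
    ∑ j ∈ Finset.range K, (X i (j + 1) - X i j) ^ 2 ≤ verticalEnergy K X :=
  sum_comp_le_of_injOn (φ := fun j => (i, j))
    (F := fun p : ℕ × ℕ => (X p.1 (p.2 + 1) - X p.1 p.2) ^ 2)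
    (fun _ _ _ _ h => (Prod.mk.inj h).2)
    (fun i hi => by simp only [Finset.mem_product, Finset.mem_range] at *; omega)
    (fun _ _ => sq_nonneg _)

/-- The average of row `j`. -/
noncomputable def rowAverage (K : ℕ) (X : ℕ → ℕ → ℝ) (j : ℕ) : ℝ :=
  (∑ i ∈ Finset.range (K + 1), X i j) / (Finset.range (K + 1)).card

/-- Consecutive rows are joined by K + 1 parallel edges, which compensates the path length of at
most K rows: no logarithm arises. -/
lemma sq_rowAverage_sub_le {K j j' : ℕ} (X : ℕ → ℕ → ℝ) (hj : j ≤ K) (hj' : j' ≤ K) :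
    (rowAverage K X j - rowAverage K X j') ^ 2 ≤ verticalEnergy K X := by
  refine (sq_sub_le_path hj hj' (d := K) (by omega) (by omega)).trans ?_
  have h1 : ∀ j, (rowAverage K X (j + 1) - rowAverage K X j) ^ 2 ≤
      (∑ i ∈ Finset.range (K + 1), (X i (j + 1) - X i j) ^ 2) / (K + 1) := by
    intro j
    have := sq_average_sub_le (s := Finset.range (K + 1)) (by simp)
      (fun i => X i (j + 1) - X i j) 0
    simp only [Finset.sum_sub_distrib, sub_zero, Finset.card_range] at this
    rw [rowAverage, rowAverage, ← sub_div, Finset.card_range]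
    simpa using this
  have h2 : ∑ j ∈ Finset.range K, (rowAverage K X (j + 1) - rowAverage K X j) ^ 2 ≤
      verticalEnergy K X / (K + 1) := by
    refine (Finset.sum_le_sum fun j _ => h1 j).trans ?_
    rw [← Finset.sum_div, verticalEnergy, Finset.sum_product_right]
  calc _ ≤ (K : ℝ) * (verticalEnergy K X / (K + 1)) := by gcongr
    _ = verticalEnergy K X * (K / (K + 1)) := by ring
    _ ≤ verticalEnergy K X * 1 := by
      gcongr
      · exact verticalEnergy_nonneg K X
      · exact (div_le_one (by positivity)).2 (by linarith)
    _ = _ := mul_one _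

lemma sq_sub_rowAverage_le {K i j : ℕ} (X : ℕ → ℕ → ℝ) (hi : i ≤ K) :
    (X i j - rowAverage K X j) ^ 2 ≤ K * ∑ i ∈ Finset.range K, (X (i + 1) j - X i j) ^ 2 := by
  rw [← neg_sq, neg_sub]
  refine sq_average_sub_le_of_forall (by simp) fun i' hi' => ?_
  have := Finset.mem_range.1 hi'
  exact sq_sub_le_path (Z := fun i => X i j) (by omega) hi (by omega) (by omega)

/-- Logarithmic bound for the effective resistance in the square lattice `{0, …, K}²`. -/
lemma sq_sub_rowAverage_zero_le {K k₁ k₂ : ℕ} (X : ℕ → ℕ → ℝ) (h₁ : k₁ ≤ K) (h₂ : k₂ ≤ K) :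
    (X k₁ k₂ - rowAverage K X 0) ^ 2 ≤
      (12 + 4 * Real.log (K + 1)) * (horizontalEnergy K X + verticalEnergy K X) := by
  obtain ⟨f, e, f0, fK, finj, eK, einj, hfe⟩ := exists_straight_walk h₁
  obtain ⟨f', e', f0', fK', finj', eK', einj', hfe'⟩ := exists_straight_walk h₂
  set D := K / 2 with hD
  set H := horizontalEnergy K X with hH
  set W := verticalEnergy K X with hW
  have hH0 : 0 ≤ H := horizontalEnergy_nonneg K X
  have hW0 : 0 ≤ W := verticalEnergy_nonneg K X
  -- A triangle of side `D` with its corner at (k₁, k₂), unfolded in whichever directions have room;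
  -- `e` and `e'` name the lower endpoints of the edges walked.
  let Y : ℕ → ℕ → ℝ := fun i j => X (f i) (f' j)
  set A := (∑ p ∈ antidiagonal D, Y p.1 p.2) / ((D : ℝ) + 1) with hA
  have htri : ∑ d ∈ Finset.range D, ∑ p ∈ antidiagonal d,
      ((Y (p.1 + 1) p.2 - Y p.1 p.2) ^ 2 + (Y p.1 (p.2 + 1) - Y p.1 p.2) ^ 2) ≤ H + W := by
    simp only [Finset.sum_add_distrib]
    gcongr
    · rw [Finset.sum_sigma']
      have h1 : ∀ x ∈ (Finset.range D).sigma fun d => antidiagonal d,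
          (Y (x.2.1 + 1) x.2.2 - Y x.2.1 x.2.2) ^ 2 =
          (fun p : ℕ × ℕ => (X (p.1 + 1) p.2 - X p.1 p.2) ^ 2) (e x.2.1, f' x.2.2) := by
        rintro ⟨d, p⟩ hx
        simp only [Finset.mem_sigma, Finset.mem_range, Finset.HasAntidiagonal.mem_antidiagonal] at hx
        exact hfe p.1 (by omega) (fun i => X i (f' p.2))
      rw [Finset.sum_congr rfl h1]
      refine sum_comp_le_of_injOn (t := Finset.range K ×ˢ Finset.range (K + 1))
        (φ := fun x : (_ : ℕ) × ℕ × ℕ => (e x.2.1, f' x.2.2))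
        (F := fun p : ℕ × ℕ => (X (p.1 + 1) p.2 - X p.1 p.2) ^ 2) ?_ ?_ fun _ _ => sq_nonneg _
      · rintro ⟨d, p⟩ hx ⟨d', p'⟩ hx' hxx
        simp only [Finset.coe_sigma, Set.mem_sigma_iff, Finset.mem_coe, Finset.mem_range,
          Finset.HasAntidiagonal.mem_antidiagonal, Prod.mk.injEq] at hx hx' hxx
        have h2 := einj (show p.1 < D by omega) (show p'.1 < D by omega) hxx.1
        have h3 := finj' (show p.2 ≤ D by omega) (show p'.2 ≤ D by omega) hxx.2
        have h4 : p = p' := Prod.ext h2 h3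
        subst h4
        have h5 : d = d' := by omega
        subst h5
        rfl
      · rintro ⟨d, p⟩ hx
        simp only [Finset.mem_sigma, Finset.mem_range, Finset.HasAntidiagonal.mem_antidiagonal] at hx
        simp only [Finset.mem_product, Finset.mem_range]
        have := eK p.1 (by omega)
        have := fK' p.2 (by omega)
        omega
    · rw [Finset.sum_sigma']
      have h1 : ∀ x ∈ (Finset.range D).sigma fun d => antidiagonal d,
          (Y x.2.1 (x.2.2 + 1) - Y x.2.1 x.2.2) ^ 2 =
          (fun p : ℕ × ℕ => (X p.1 (p.2 + 1) - X p.1 p.2) ^ 2) (f x.2.1, e' x.2.2) := by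
        rintro ⟨d, p⟩ hx
        simp only [Finset.mem_sigma, Finset.mem_range, Finset.HasAntidiagonal.mem_antidiagonal] at hx
        exact hfe' p.2 (by omega) (fun j => X (f p.1) j)
      rw [Finset.sum_congr rfl h1]
      refine sum_comp_le_of_injOn (t := Finset.range (K + 1) ×ˢ Finset.range K)
        (φ := fun x : (_ : ℕ) × ℕ × ℕ => (f x.2.1, e' x.2.2))
        (F := fun p : ℕ × ℕ => (X p.1 (p.2 + 1) - X p.1 p.2) ^ 2) ?_ ?_ fun _ _ => sq_nonneg _
      · rintro ⟨d, p⟩ hx ⟨d', p'⟩ hx' hxx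
        simp only [Finset.coe_sigma, Set.mem_sigma_iff, Finset.mem_coe, Finset.mem_range,
          Finset.HasAntidiagonal.mem_antidiagonal, Prod.mk.injEq] at hx hx' hxx
        have h2 := finj (show p.1 ≤ D by omega) (show p'.1 ≤ D by omega) hxx.1
        have h3 := einj' (show p.2 < D by omega) (show p'.2 < D by omega) hxx.2
        have h4 : p = p' := Prod.ext h2 h3
        subst h4
        have h5 : d = d' := by omega
        subst h5
        rfl
      · rintro ⟨d, p⟩ hx
        simp only [Finset.mem_sigma, Finset.mem_range, Finset.HasAntidiagonal.mem_antidiagonal] at hx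
        simp only [Finset.mem_product, Finset.mem_range]
        have := eK' p.2 (by omega)
        have := fK p.1 (by omega)
        omega
  have hcorner : (A - X k₁ k₂) ^ 2 ≤ 2 * (1 + Real.log (K + 1)) * (H + W) := by
    have h1 := sq_corner_sub_antidiagonal_average_le Y D
    simp only [Y, f0, f0'] at h1
    have h2 : Real.log D ≤ Real.log (K + 1) := by
      rcases Nat.eq_zero_or_pos D with h | h
      · rw [h]
        simpa using Real.log_nonneg (by linarith [Nat.cast_nonneg (α := ℝ) K] : (1 : ℝ) ≤ K + 1)
      · refine Real.log_le_log (by exact_mod_cast h) ?_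
        exact_mod_cast (by omega : D ≤ K + 1)
    have h3 : 0 ≤ Real.log D := Real.log_natCast_nonneg D
    have h4 : 0 ≤ Real.log (K + 1) := h3.trans h2
    refine h1.trans ?_
    gcongr
  -- The points of the last antidiagonal lie in D + 1 distinct rows. Joining each to its row average
  -- costs K times the row energy, and averaging divides by D + 1 ≥ K/2. Row averages are then
  -- compared with row 0, a reference independent of the point.
  have hrow : (A - rowAverage K X 0) ^ 2 ≤ 4 * H + 2 * W := by
    have hcard : ((antidiagonal D).card : ℝ) = D + 1 := by
      rw [Finset.Nat.card_antidiagonal]; push_cast; rfl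
    have h1 := sq_average_sub_le (s := antidiagonal D)
      (Finset.card_pos.1 (by simp)) (fun p => Y p.1 p.2) (rowAverage K X 0)
    rw [hcard] at h1
    refine h1.trans ?_
    rw [div_le_iff₀ (by positivity)]
    have h2 : ∀ p ∈ antidiagonal D, (Y p.1 p.2 - rowAverage K X 0) ^ 2 ≤
        2 * (K * ∑ i ∈ Finset.range K, (X (i + 1) (f' p.2) - X i (f' p.2)) ^ 2) + 2 * W := by
      intro p hp
      have hp' := Finset.HasAntidiagonal.mem_antidiagonal.1 hp
      have ha := sq_sub_rowAverage_le X (j := f' p.2) (fK p.1 (by omega))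
      have hb := sq_rowAverage_sub_le X (fK' p.2 (by omega)) (Nat.zero_le K)
      have hc : Y p.1 p.2 - rowAverage K X 0 = (X (f p.1) (f' p.2) - rowAverage K X (f' p.2)) +
        (rowAverage K X (f' p.2) - rowAverage K X 0) := by simp only [Y]; ring
      rw [hc]
      refine add_sq_le.trans ?_
      linarith
    refine (Finset.sum_le_sum h2).trans ?_
    rw [Finset.sum_add_distrib, ← Finset.mul_sum, ← Finset.mul_sum, Finset.sum_const,
      Finset.Nat.card_antidiagonal, nsmul_eq_mul]
    have h3 : ∑ p ∈ antidiagonal D, ∑ i ∈ Finset.range K,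
        (X (i + 1) (f' p.2) - X i (f' p.2)) ^ 2 ≤ H := by
      rw [← Finset.sum_product']
      refine sum_comp_le_of_injOn (t := Finset.range K ×ˢ Finset.range (K + 1))
        (φ := fun x : (ℕ × ℕ) × ℕ => (x.2, f' x.1.2))
        (F := fun p : ℕ × ℕ => (X (p.1 + 1) p.2 - X p.1 p.2) ^ 2) ?_ ?_ fun _ _ => sq_nonneg _
      · rintro ⟨p, i⟩ hx ⟨p', i'⟩ hx' hxx
        simp only [Finset.coe_product, Set.mem_prod, Finset.mem_coe, Finset.mem_range,
          Finset.HasAntidiagonal.mem_antidiagonal, Prod.mk.injEq] at hx hx' hxx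
        have h4 := finj' (show p.2 ≤ D by omega) (show p'.2 ≤ D by omega) hxx.2
        have h5 : p.1 = p'.1 := by omega
        exact Prod.ext (Prod.ext h5 h4) hxx.1
      · rintro ⟨p, i⟩ hx
        simp only [Finset.mem_product, Finset.mem_range, Finset.HasAntidiagonal.mem_antidiagonal] at hx ⊢
        have := fK' p.2 (by omega)
        omega
    have h6 : (K : ℝ) ≤ 2 * (D + 1) := by
      exact_mod_cast (by omega : K ≤ 2 * (D + 1))
    push_cast
    have h7 : (K : ℝ) * ∑ p ∈ antidiagonal D, ∑ i ∈ Finset.range K,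
        (X (i + 1) (f' p.2) - X i (f' p.2)) ^ 2 ≤ (2 * (D + 1)) * H := by gcongr
    linarith
  have hsplit : X k₁ k₂ - rowAverage K X 0 = -(A - X k₁ k₂) + (A - rowAverage K X 0) := by ring
  rw [hsplit]
  refine add_sq_le.trans ?_
  rw [neg_sq]
  linarith

end Lattice

/-! ### Energy comparison between a graph and its block averages. -/

section Blocks

variable {V : Type*} [LinearOrder V] [Fintype V]

lemma energy_nonneg (G : SimpleGraph V) (x : V → ℝ) : 0 ≤ energy G x :=
  Finset.sum_nonneg fun _ _ => sq_nonneg _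

open scoped Classical in
-- The ordered pairs are distinct, so each edge is used at most once in each orientation, whence the
-- factor 2; pairs with equal entries contribute 0.
lemma sum_sq_sub_le_energy (G : SimpleGraph V) (x : V → ℝ) {α : Type*} {A : Finset α}
    {f g : α → V} (hinj : Set.InjOn (fun a => (f a, g a)) A)
    (hadj : ∀ a ∈ A, f a = g a ∨ G.Adj (f a) (g a)) :
    ∑ a ∈ A, (x (f a) - x (g a)) ^ 2 ≤ 2 * energy G x := by
  let F₁ : V × V → ℝ := fun p =>
    if G.Adj p.1 p.2 ∧ p.1 < p.2 then (x p.1 - x p.2) ^ 2 else 0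
  have hF₁ : ∑ p, F₁ p = energy G x := by
    simp only [F₁]
    rw [← Finset.sum_filter, energy]
    exact (Finset.sum_subtype (p := fun p : V × V => G.Adj p.1 p.2 ∧ p.1 < p.2)
      (Finset.univ.filter fun p : V × V => G.Adj p.1 p.2 ∧ p.1 < p.2) (by simp)
      (fun p => (x p.1 - x p.2) ^ 2))
  have hF₁0 : ∀ p, 0 ≤ F₁ p := fun p => by
    simp only [F₁]
    split_ifs
    · exact sq_nonneg _
    · exact le_rfl
  have hswap : ∑ p : V × V, F₁ p.swap = energy G x := by
    rw [← hF₁]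
    exact (Equiv.prodComm V V).sum_comp F₁
  calc _ ≤ ∑ a ∈ A, (fun p : V × V => F₁ p + F₁ p.swap) (f a, g a) := by
        refine Finset.sum_le_sum fun a ha => ?_
        rcases hadj a ha with h | h
        · rw [h, sub_self]
          simpa using add_nonneg (hF₁0 (g a, g a)) (hF₁0 (g a, g a))
        · rcases lt_trichotomy (f a) (g a) with h1 | h1 | h1
          · refine le_add_of_le_of_nonneg ?_ (hF₁0 _)
            simp [F₁, h, h1]
          · exact absurd h1 h.ne
          · refine le_add_of_nonneg_of_le (hF₁0 _) ?_
            simp only [F₁, Prod.swap, h.symm, h1, and_self, if_true]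
            rw [← neg_sq, neg_sub]
    _ ≤ ∑ p : V × V, (F₁ p + F₁ p.swap) :=
        sum_comp_le_of_injOn (F := fun p : V × V => F₁ p + F₁ p.swap) hinj
          (fun _ _ => Finset.mem_univ _) fun p _ => add_nonneg (hF₁0 _) (hF₁0 _)
    _ = 2 * energy G x := by rw [Finset.sum_add_distrib, hF₁, hswap, two_mul]

variable {B U : Type*} [Fintype U]

/-- The average of `x` over the block `b`, whose points are `φ b u`. -/
noncomputable def blockAverage (φ : B → U → V) (x : V → ℝ) (b : B) : ℝ :=
  (∑ u, x (φ b u)) / (Finset.univ : Finset U).card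

lemma sq_sub_blockAverage_le [Nonempty U] (G : SimpleGraph V) (φ : B → U → V) (x : V → ℝ) {k : V}
    {b : B} (hinj : Function.Injective (φ b)) (hadj : ∀ u, φ b u = k ∨ G.Adj (φ b u) k) :
    (blockAverage φ x b - x k) ^ 2 ≤ 2 * energy G x / Fintype.card U := by
  refine (sq_average_sub_le Finset.univ_nonempty _ _).trans ?_
  rw [Finset.card_univ]
  gcongr
  exact sum_sq_sub_le_energy G x (g := fun _ => k)
    (fun u _ v _ h => hinj (Prod.mk.inj h).1) (fun u _ => hadj u)

/-- Two linked blocks span a complete bipartite graph up to coinciding points, so Jensen over its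
|U|² pairs gains the factor 1/|U|². By `hinj`, different links use different pairs. -/
lemma sum_sq_blockAverage_sub_le [Nonempty U] (G : SimpleGraph V) (φ : B → U → V) (x : V → ℝ)
    {α : Type*} {A : Finset α} {b b' : α → B}
    (hinj : ∀ a ∈ A, ∀ a' ∈ A, ∀ u u' v v', φ (b a) u = φ (b a') u' → φ (b' a) v = φ (b' a') v' →
      a = a' ∧ u = u' ∧ v = v')
    (hadj : ∀ a ∈ A, ∀ u v, φ (b a) u = φ (b' a) v ∨ G.Adj (φ (b a) u) (φ (b' a) v)) :
    ∑ a ∈ A, (blockAverage φ x (b a) - blockAverage φ x (b' a)) ^ 2 ≤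
      2 * energy G x / (Fintype.card U : ℝ) ^ 2 := by
  have h1 : ∀ a ∈ A, (blockAverage φ x (b a) - blockAverage φ x (b' a)) ^ 2 ≤
      (∑ p : U × U, (x (φ (b a) p.1) - x (φ (b' a) p.2)) ^ 2) / (Fintype.card U : ℝ) ^ 2 := by
    intro a _
    have := sq_average_sub_average_le (s := (Finset.univ : Finset U))
      (t := (Finset.univ : Finset U)) Finset.univ_nonempty Finset.univ_nonempty
      (fun u => x (φ (b a) u)) (fun u => x (φ (b' a) u))
    rwa [Finset.card_univ, ← sq, Finset.univ_product_univ] at this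
  refine (Finset.sum_le_sum h1).trans ?_
  rw [← Finset.sum_div, ← Finset.sum_product']
  gcongr
  refine sum_sq_sub_le_energy G x (f := fun q : α × U × U => φ (b q.1) q.2.1)
    (g := fun q : α × U × U => φ (b' q.1) q.2.2) ?_ ?_
  · rintro ⟨a, u, v⟩ ha ⟨a', u', v'⟩ ha' h
    simp only [Finset.coe_product, Set.mem_prod, Finset.mem_coe] at ha ha'
    obtain ⟨h2, h3⟩ := Prod.mk.inj h
    obtain ⟨rfl, rfl, rfl⟩ := hinj a ha.1 a' ha'.1 u u' v v' h2 h3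
    rfl
  · rintro ⟨a, u, v⟩ ha
    exact hadj a (Finset.mem_product.1 ha).1 u v

lemma sq_sub_le_of_three {a b c d α β : ℝ} (h₁ : (b - a) ^ 2 ≤ α) (h₂ : (b - c) ^ 2 ≤ β)
    (h₃ : (c - d) ^ 2 ≤ α) : (a - d) ^ 2 ≤ 6 * α + 3 * β := by
  nlinarith [sq_nonneg ((b - a) + (b - c)), sq_nonneg ((b - c) - (c - d)),
    sq_nonneg ((b - a) + (c - d))]

end Blocks

/-! ### Cutting an interval into blocks. -/

section Division

/-- The position `u` of the block of length `h` with index `a`. -/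
def blockPoint (n : ℕ) [NeZero n] {h : ℕ} (a : ℕ) (u : Fin h) : Fin n := Fin.ofNat n (a * h + u)

/-- The index of a block near `i`, among blocks `0, …, n / h - 1`. -/
def blockIndex (n h : ℕ) (i : Fin n) : ℕ := min (i / h) (n / h - 1)

lemma blockIndex_lt {n h : ℕ} (hh : 0 < h) (hn : h ≤ n) (i : Fin n) :
    blockIndex n h i < n / h := by
  have := Nat.div_pos hn hh
  simp only [blockIndex]
  omega

lemma blockIndex_le_add {n h : ℕ} {i j : Fin n} {c : ℕ} (hh : 0 < h)
    (hij : (j : ℕ) ≤ i + c * h) : blockIndex n h j ≤ blockIndex n h i + c := by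
  have h1 := Nat.div_le_div_right (c := h) hij
  rw [Nat.add_mul_div_right _ _ hh] at h1
  simp only [blockIndex]
  omega

variable {n h : ℕ} [NeZero n]

lemma blockPoint_val {a : ℕ} (u : Fin h) (ha : a < n / h) :
    (blockPoint n a u : ℕ) = a * h + u := by
  refine Nat.mod_eq_of_lt ?_
  have h1 := Nat.mul_le_mul_right h (show a + 1 ≤ n / h from ha)
  have h2 := Nat.div_mul_le_self n h
  have h3 := u.2
  rw [add_mul] at h1
  omega

lemma blockPoint_inj {a a' : ℕ} {u u' : Fin h} (ha : a < n / h) (ha' : a' < n / h)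
    (heq : blockPoint n a u = blockPoint n a' u') : a = a' ∧ u = u' := by
  have h1 := congrArg Fin.val heq
  rw [blockPoint_val u ha, blockPoint_val u' ha'] at h1
  have hu := u.2
  have hu' := u'.2
  have h2 : a = a' := by
    rcases lt_trichotomy a a' with hlt | heq | hlt
    · have := Nat.mul_le_mul_right h (Nat.succ_le_of_lt hlt)
      rw [Nat.succ_mul] at this
      omega
    · exact heq
    · have := Nat.mul_le_mul_right h (Nat.succ_le_of_lt hlt)
      rw [Nat.succ_mul] at this
      omega
  subst h2
  exact ⟨rfl, Fin.ext (by omega)⟩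

/-- The at most h - 1 positions beyond the last full block are attached to it, so the distance can
reach 2h - 2 instead of h - 1. -/
lemma abs_blockPoint_sub_le (hh : 0 < h) (hn : h ≤ n) (i : Fin n) (u : Fin h) :
    |((blockPoint n (blockIndex n h i) u : ℕ) : ℤ) - ((i : ℕ) : ℤ)| ≤ 2 * h - 2 := by
  rw [blockPoint_val u (blockIndex_lt hh hn i)]
  have hu := u.2
  have hi := i.2
  have h1 := Nat.div_add_mod (i : ℕ) h
  have h2 := Nat.mod_lt (i : ℕ) hh
  have h3 := Nat.div_add_mod n h
  have h4 := Nat.mod_lt n hh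
  have h5 := Nat.div_pos hn hh
  simp only [blockIndex]
  generalize (i : ℕ) / h = q at *
  generalize (i : ℕ) % h = s at *
  obtain ⟨M, hM⟩ : ∃ M, n / h = M + 1 := ⟨n / h - 1, by omega⟩
  rw [hM] at h3 ⊢
  generalize n % h = t at *
  rw [mul_add, mul_one, mul_comm h M] at h3
  rw [mul_comm] at h1
  rw [abs_le, Nat.add_sub_cancel]
  rcases le_or_gt q M with h | hgt
  · rw [min_eq_left h]
    push_cast
    zify at *
    constructor <;> linarith
  · have h6 := Nat.mul_le_mul_right h (Nat.succ_le_of_lt hgt)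
    rw [Nat.succ_mul] at h6
    rw [min_eq_right hgt.le]
    push_cast
    zify at *
    constructor <;> linarith

lemma abs_blockPoint_sub_same_le {a : ℕ} (ha : a < n / h) (u v : Fin h) :
    |((blockPoint n a u : ℕ) : ℤ) - ((blockPoint n a v : ℕ) : ℤ)| ≤ h - 1 := by
  rw [blockPoint_val u ha, blockPoint_val v ha, abs_le]
  have := u.2
  have := v.2
  push_cast
  constructor <;> omega

lemma abs_blockPoint_succ_sub_le {a : ℕ} (ha : a + 1 < n / h) (u v : Fin h) :
    |((blockPoint n (a + 1) u : ℕ) : ℤ) - ((blockPoint n a v : ℕ) : ℤ)| ≤ 2 * h - 1 := by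
  rw [blockPoint_val u ha, blockPoint_val v (by omega), abs_le, Nat.succ_mul]
  have := u.2
  have := v.2
  push_cast
  constructor <;> omega

end Division

/-! ### Resistances and edges of the one-dimensional grid. -/

section OneDimensional

lemma grid1D_eq_or_adj {n r : ℕ} {i j : Fin n} (h : |((i : ℕ) : ℤ) - ((j : ℕ) : ℤ)| ≤ r) :
    i = j ∨ (grid1D n r).Adj i j := by
  rcases eq_or_ne i j with h' | h'
  · exact Or.inl h'
  · exact Or.inr ⟨h', h⟩

/-- Go from `k` to its block average, along at most `d` blocks, and back to `l`. The condition 2h -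
1 ≤ r makes all points of neighbouring blocks adjacent. -/
lemma grid1D_sq_sub_le {n r h d : ℕ} [NeZero n] (hh : 0 < h) (hn : h ≤ n) (hhr : 2 * h ≤ r + 1)
    {k l : Fin n} (hkl : blockIndex n h k ≤ blockIndex n h l + d)
    (hlk : blockIndex n h l ≤ blockIndex n h k + d) (x : Fin n → ℝ) :
    (x k - x l) ^ 2 ≤ (12 / h + 6 * d / (h : ℝ) ^ 2) * energy (grid1D n r) x := by
  have : Nonempty (Fin h) := ⟨⟨0, hh⟩⟩
  set E := energy (grid1D n r) x with hE
  let φ : ℕ → Fin h → Fin n := fun a u => blockPoint n a u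
  have hM := Nat.div_pos hn hh
  have hpt : ∀ i : Fin n, (blockAverage φ x (blockIndex n h i) - x i) ^ 2 ≤ 2 * E / h := by
    intro i
    have := sq_sub_blockAverage_le (grid1D n r) φ x (k := i) (b := blockIndex n h i)
      (fun u v huv => (blockPoint_inj (blockIndex_lt hh hn i) (blockIndex_lt hh hn i) huv).2)
      (fun u => grid1D_eq_or_adj ((abs_blockPoint_sub_le hh hn i u).trans (by omega)))
    rwa [Fintype.card_fin] at this
  have hblocks : ∑ a ∈ Finset.range (n / h - 1),
      (blockAverage φ x (a + 1) - blockAverage φ x a) ^ 2 ≤ 2 * E / (h : ℝ) ^ 2 := by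
    have := sum_sq_blockAverage_sub_le (grid1D n r) φ x (A := Finset.range (n / h - 1))
      (b := fun a => a + 1) (b' := fun a => a) ?_ ?_
    · rwa [Fintype.card_fin] at this
    · intro a ha a' ha' u u' v v' h1 h2
      rw [Finset.mem_range] at ha ha'
      have h3 := blockPoint_inj (by omega) (by omega) h1
      have h4 := blockPoint_inj (by omega) (by omega) h2
      exact ⟨h4.1, h3.2, h4.2⟩
    · intro a ha u v
      rw [Finset.mem_range] at ha
      exact grid1D_eq_or_adj ((abs_blockPoint_succ_sub_le (by omega) u v).trans (by omega))
  have hmid := sq_sub_le_path (Z := blockAverage φ x) (K := n / h - 1)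
    (Nat.le_pred_of_lt (blockIndex_lt hh hn k)) (Nat.le_pred_of_lt (blockIndex_lt hh hn l)) hkl hlk
  have hmid' := hmid.trans (mul_le_mul_of_nonneg_left hblocks (Nat.cast_nonneg d))
  refine (sq_sub_le_of_three (hpt k) hmid' ?_).trans (le_of_eq ?_)
  · exact hpt l
  · ring

lemma grid1D_resistance_edge {n r : ℕ} (hr : 1 ≤ r) (hrn : r ≤ n) {k l : Fin n}
    (hkl : (grid1D n r).Adj k l) (x : Fin n → ℝ) :
    (x k - x l) ^ 2 ≤ 48 / r * energy (grid1D n r) x := by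
  have : NeZero n := ⟨by omega⟩
  obtain ⟨-, hd⟩ := hkl
  rw [abs_le] at hd
  set h := (r + 1) / 2 with hh
  have hpos : 0 < h := by omega
  -- Adjacent nodes are at distance at most r ≤ 2h, hence at most two blocks apart.
  refine (grid1D_sq_sub_le (r := r) (d := 2) hpos (by omega) (by omega)
    (blockIndex_le_add hpos (by omega)) (blockIndex_le_add hpos (by omega)) x).trans ?_
  refine mul_le_mul_of_nonneg_right ?_ (energy_nonneg _ _)
  have h1 : (1 : ℝ) ≤ h := by exact_mod_cast hpos
  have h2 : (r : ℝ) ≤ 2 * h := by exact_mod_cast (by omega : r ≤ 2 * h)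
  have hr0 : (0 : ℝ) < r := by exact_mod_cast hr
  push_cast
  calc (12 : ℝ) / h + 6 * 2 / (h : ℝ) ^ 2 ≤ 12 / h + 6 * 2 / h := by
        gcongr
        nlinarith
    _ = 24 / h := by ring
    _ ≤ 48 / r := by
        rw [div_le_div_iff₀ (by positivity) hr0]
        linarith

lemma grid1D_resistance {n r : ℕ} (hr : 1 ≤ r) (hrn : r ≤ n) (k l : Fin n) (x : Fin n → ℝ) :
    (x k - x l) ^ 2 ≤ 48 * ((n : ℝ) / (r : ℝ) ^ 2 + 1) / r * energy (grid1D n r) x := by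
  have : NeZero n := ⟨by omega⟩
  set h := (r + 1) / 2 with hh
  have hpos : 0 < h := by omega
  have hhn : h ≤ n := by omega
  have hk := blockIndex_lt hpos hhn k
  have hl := blockIndex_lt hpos hhn l
  refine (grid1D_sq_sub_le (r := r) (d := n / h) hpos hhn (by omega) (by omega) (by omega) x).trans ?_
  refine mul_le_mul_of_nonneg_right ?_ (energy_nonneg _ _)
  have h1 : (1 : ℝ) ≤ h := by exact_mod_cast hpos
  have h2 : (r : ℝ) / 2 ≤ h := by
    have : (r : ℝ) ≤ 2 * h := by exact_mod_cast (by omega : r ≤ 2 * h)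
    linarith
  have hr0 : (0 : ℝ) < r := by exact_mod_cast hr
  have h3 : ((n / h : ℕ) : ℝ) ≤ n / h := Nat.cast_div_le
  calc (12 : ℝ) / h + 6 * (n / h : ℕ) / (h : ℝ) ^ 2 ≤ 12 / h + 6 * (n / h) / (h : ℝ) ^ 2 := by
        gcongr
    _ = 12 / h + 6 * n / (h : ℝ) ^ 3 := by field_simp
    _ ≤ 12 / (r / 2) + 6 * n / (r / 2 : ℝ) ^ 3 := by gcongr
    _ = 48 * ((n : ℝ) / (r : ℝ) ^ 2 + 1) / r - 24 / r := by field_simp; ring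
    _ ≤ _ := by
        have : 0 < 24 / (r : ℝ) := by positivity
        linarith

open scoped Classical in
lemma grid1D_card_edges_le {n r : ℕ} (hr : 1 ≤ r) :
    Fintype.card (OrientedEdge (grid1D n r)) ≤ 2 * (n * r) := by
  have h : Fintype.card (OrientedEdge (grid1D n r)) ≤ Fintype.card (Fin n × Fin (r + 1)) := by
    refine Fintype.card_le_of_injective
      (fun e => (e.1.1, ⟨(e.1.2 : ℕ) - e.1.1, ?_⟩)) ?_
    · have h1 := e.2.1.2
      rw [abs_le] at h1
      omega
    · rintro ⟨⟨i, j⟩, he⟩ ⟨⟨i', j'⟩, he'⟩ h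
      obtain ⟨h1, h2⟩ := Prod.mk.inj h
      have h3 : (j : ℕ) - i = (j' : ℕ) - i' := congrArg Fin.val h2
      have h4 : (i : ℕ) < j := he.2
      have h5 : (i' : ℕ) < j' := he'.2
      have h6 : i = i' := h1
      subst h6
      have h7 : j = j' := Fin.ext (by omega)
      subst h7
      rfl
  rw [Fintype.card_prod, Fintype.card_fin, Fintype.card_fin] at h
  nlinarith

end OneDimensional

/-! ### Resistances and edges of the two-dimensional grid. -/

section TwoDimensional

lemma grid2D_eq_or_adj {m r : ℕ} {i j : Fin m ×ₗ Fin m} {c d : ℤ}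
    (h₁ : |(((ofLex i).1 : ℕ) : ℤ) - (((ofLex j).1 : ℕ) : ℤ)| ≤ c)
    (h₂ : |(((ofLex i).2 : ℕ) : ℤ) - (((ofLex j).2 : ℕ) : ℤ)| ≤ d) (hr : c + d ≤ r) :
    i = j ∨ (grid2D m r).Adj i j := by
  rcases eq_or_ne i j with h' | h'
  · exact Or.inl h'
  · exact Or.inr ⟨h', (add_le_add h₁ h₂).trans hr⟩

/-- The points of the square block with index `a`. -/
def squareBlockPoint (m : ℕ) [NeZero m] {h : ℕ} (a : ℕ × ℕ) (u : Fin h × Fin h) :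
    Fin m ×ₗ Fin m :=
  toLex (blockPoint m a.1 u.1, blockPoint m a.2 u.2)

lemma squareBlockPoint_inj {m h : ℕ} [NeZero m] {a a' : ℕ × ℕ} {u u' : Fin h × Fin h}
    (h₁ : a.1 < m / h) (h₂ : a.2 < m / h) (h₁' : a'.1 < m / h) (h₂' : a'.2 < m / h)
    (heq : squareBlockPoint m a u = squareBlockPoint m a' u') : a = a' ∧ u = u' := by
  obtain ⟨h3, h4⟩ := Prod.mk.inj (toLex.injective heq)
  obtain ⟨h5, h6⟩ := blockPoint_inj h₁ h₁' h3
  obtain ⟨h7, h8⟩ := blockPoint_inj h₂ h₂' h4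
  exact ⟨Prod.ext h5 h7, Prod.ext h6 h8⟩

/-- The average of `x` over the square block `(a, b)`. -/
noncomputable def squareAverage (m h : ℕ) [NeZero m] (x : Fin m ×ₗ Fin m → ℝ) (a b : ℕ) : ℝ :=
  blockAverage (squareBlockPoint m (h := h)) x (a, b)

variable {m r h : ℕ} [NeZero m]

lemma sq_squareAverage_sub_le (hh : 0 < h) (hm : h ≤ m) (hhr : 4 * h ≤ r + 4)
    (x : Fin m ×ₗ Fin m → ℝ) (i : Fin m ×ₗ Fin m) :
    (squareAverage m h x (blockIndex m h (ofLex i).1) (blockIndex m h (ofLex i).2) - x i) ^ 2 ≤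
      2 * energy (grid2D m r) x / (h : ℝ) ^ 2 := by
  have : Nonempty (Fin h) := ⟨⟨0, hh⟩⟩
  have h1 := sq_sub_blockAverage_le (grid2D m r) (squareBlockPoint m (h := h)) x (k := i)
    (b := (blockIndex m h (ofLex i).1, blockIndex m h (ofLex i).2))
    (fun u v huv => (squareBlockPoint_inj (blockIndex_lt hh hm _) (blockIndex_lt hh hm _)
      (blockIndex_lt hh hm _) (blockIndex_lt hh hm _) huv).2)
    (fun u => grid2D_eq_or_adj (abs_blockPoint_sub_le hh hm (ofLex i).1 u.1)
      (abs_blockPoint_sub_le hh hm (ofLex i).2 u.2) (by omega))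
  rw [Fintype.card_prod, Fintype.card_fin, Nat.cast_mul, ← sq] at h1
  exact h1

lemma horizontalEnergy_squareAverage_le (hh : 0 < h) (hm : h ≤ m) (hhr : 3 * h ≤ r + 2)
    (x : Fin m ×ₗ Fin m → ℝ) :
    horizontalEnergy (m / h - 1) (squareAverage m h x) ≤
      2 * energy (grid2D m r) x / (h : ℝ) ^ 4 := by
  have : Nonempty (Fin h) := ⟨⟨0, hh⟩⟩
  have hM := Nat.div_pos hm hh
  have h1 := sum_sq_blockAverage_sub_le (grid2D m r) (squareBlockPoint m (h := h)) x
    (A := Finset.range (m / h - 1) ×ˢ Finset.range (m / h - 1 + 1))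
    (b := fun p => (p.1 + 1, p.2)) (b' := fun p => p) ?_ ?_
  · rw [Fintype.card_prod, Fintype.card_fin, Nat.cast_mul, ← sq, ← pow_mul] at h1
    exact h1
  · intro a ha a' ha' u u' v v' h1 h2
    simp only [Finset.mem_product, Finset.mem_range] at ha ha'
    have h3 := squareBlockPoint_inj (by dsimp only; omega) (by dsimp only; omega)
      (by dsimp only; omega) (by dsimp only; omega) h1
    have h4 := squareBlockPoint_inj (by omega) (by omega) (by omega) (by omega) h2
    exact ⟨h4.1, h3.2, h4.2⟩
  · intro a ha u v
    simp only [Finset.mem_product, Finset.mem_range] at ha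
    exact grid2D_eq_or_adj (abs_blockPoint_succ_sub_le (by omega) u.1 v.1)
      (abs_blockPoint_sub_same_le (by omega) u.2 v.2) (by omega)

lemma verticalEnergy_squareAverage_le (hh : 0 < h) (hm : h ≤ m) (hhr : 3 * h ≤ r + 2)
    (x : Fin m ×ₗ Fin m → ℝ) :
    verticalEnergy (m / h - 1) (squareAverage m h x) ≤
      2 * energy (grid2D m r) x / (h : ℝ) ^ 4 := by
  have : Nonempty (Fin h) := ⟨⟨0, hh⟩⟩
  have hM := Nat.div_pos hm hh
  have h1 := sum_sq_blockAverage_sub_le (grid2D m r) (squareBlockPoint m (h := h)) x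
    (A := Finset.range (m / h - 1 + 1) ×ˢ Finset.range (m / h - 1))
    (b := fun p => (p.1, p.2 + 1)) (b' := fun p => p) ?_ ?_
  · rw [Fintype.card_prod, Fintype.card_fin, Nat.cast_mul, ← sq, ← pow_mul] at h1
    exact h1
  · intro a ha a' ha' u u' v v' h1 h2
    simp only [Finset.mem_product, Finset.mem_range] at ha ha'
    have h3 := squareBlockPoint_inj (by dsimp only; omega) (by dsimp only; omega)
      (by dsimp only; omega) (by dsimp only; omega) h1
    have h4 := squareBlockPoint_inj (by omega) (by omega) (by omega) (by omega) h2
    exact ⟨h4.1, h3.2, h4.2⟩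
  · intro a ha u v
    simp only [Finset.mem_product, Finset.mem_range] at ha
    exact grid2D_eq_or_adj (abs_blockPoint_sub_same_le (by omega) u.1 v.1)
      (abs_blockPoint_succ_sub_le (by omega) u.2 v.2) (by omega)

omit [NeZero m] in
-- Neighbours are at most four blocks apart in each coordinate, so an L-shaped path of blocks
-- suffices and no logarithm appears.
lemma grid2D_resistance_edge (hm : 1 ≤ m) (hr : 1 ≤ r) (hrm : r ≤ 2 * m)
    {k l : Fin m ×ₗ Fin m} (hkl : (grid2D m r).Adj k l) (x : Fin m ×ₗ Fin m → ℝ) :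
    (x k - x l) ^ 2 ≤ 1728 / (r : ℝ) ^ 2 * energy (grid2D m r) x := by
  have : NeZero m := ⟨by omega⟩
  obtain ⟨-, hd⟩ := hkl
  have hd1 := (le_add_of_nonneg_right (abs_nonneg _)).trans hd
  have hd2 := (le_add_of_nonneg_left (abs_nonneg _)).trans hd
  rw [abs_le] at hd1 hd2
  -- The largest side with 2(2h - 2) ≤ r, the ℓ₁ distance from a node to its block; it also
  -- satisfies 3h - 2 ≤ r, needed between neighbouring blocks.
  set h := r / 4 + 1 with hh
  have hpos : 0 < h := by omega
  have hhm : h ≤ m := by omega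
  set E := energy (grid2D m r) x with hE
  have hE0 : 0 ≤ E := energy_nonneg _ _
  set X := squareAverage m h x with hX
  have hH := horizontalEnergy_squareAverage_le (r := r) hpos hhm (by omega) x
  have hW := verticalEnergy_squareAverage_le (r := r) hpos hhm (by omega) x
  have hk1 := Nat.le_sub_one_of_lt (blockIndex_lt hpos hhm (ofLex k).1)
  have hk2 := Nat.le_sub_one_of_lt (blockIndex_lt hpos hhm (ofLex k).2)
  have hl1 := Nat.le_sub_one_of_lt (blockIndex_lt hpos hhm (ofLex l).1)
  have hl2 := Nat.le_sub_one_of_lt (blockIndex_lt hpos hhm (ofLex l).2)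
  have hp1 := sq_sub_le_path (Z := fun i => X i (blockIndex m h (ofLex k).2)) (d := 4) hk1 hl1
    (blockIndex_le_add hpos (by omega)) (blockIndex_le_add hpos (by omega))
  have hp2 := sq_sub_le_path (Z := fun j => X (blockIndex m h (ofLex l).1) j) (d := 4) hk2 hl2
    (blockIndex_le_add hpos (by omega)) (blockIndex_le_add hpos (by omega))
  have hq1 := (row_energy_le X hk2).trans hH
  have hq2 := (column_energy_le X hl1).trans hW
  have hmid : (X (blockIndex m h (ofLex k).1) (blockIndex m h (ofLex k).2) -
      X (blockIndex m h (ofLex l).1) (blockIndex m h (ofLex l).2)) ^ 2 ≤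
      32 * E / (h : ℝ) ^ 4 := by
    rw [← sub_add_sub_cancel _ (X (blockIndex m h (ofLex l).1) (blockIndex m h (ofLex k).2)) _]
    refine add_sq_le.trans ?_
    push_cast at hp1 hp2
    have : 32 * E / (h : ℝ) ^ 4 = 16 * (2 * E / (h : ℝ) ^ 4) := by ring
    rw [this]
    linarith
  refine (sq_sub_le_of_three (sq_squareAverage_sub_le (r := r) hpos hhm (by omega) x k) hmid
    (sq_squareAverage_sub_le (r := r) hpos hhm (by omega) x l)).trans ?_
  have h1 : (1 : ℝ) ≤ h := by exact_mod_cast hpos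
  have h2 : (r : ℝ) / 4 ≤ h := by
    have : (r : ℝ) ≤ 4 * h := by exact_mod_cast (by omega : r ≤ 4 * h)
    linarith
  have hr0 : (0 : ℝ) < r := by exact_mod_cast hr
  have h3 : (h : ℝ) ^ 2 ≤ (h : ℝ) ^ 4 := pow_le_pow_right₀ h1 (by norm_num)
  calc 6 * (2 * E / (h : ℝ) ^ 2) + 3 * (32 * E / (h : ℝ) ^ 4)
      ≤ 6 * (2 * E / (h : ℝ) ^ 2) + 3 * (32 * E / (h : ℝ) ^ 2) := by gcongr
    _ = 108 * E / (h : ℝ) ^ 2 := by ring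
    _ ≤ 108 * E / (r / 4 : ℝ) ^ 2 := by gcongr
    _ = _ := by
      field_simp
      norm_num
      ring

omit [NeZero m] in
lemma grid2D_resistance (hm : 1 ≤ m) (hr : 1 ≤ r) (hrm : r ≤ 2 * m) (k l : Fin m ×ₗ Fin m)
    (x : Fin m ×ₗ Fin m → ℝ) :
    (x k - x l) ^ 2 ≤ 49152 * (Real.log (m ^ 2 : ℕ) / (r : ℝ) ^ 2 + 1) / (r : ℝ) ^ 2 *
      energy (grid2D m r) x := by
  have : NeZero m := ⟨by omega⟩
  set h := r / 4 + 1 with hh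
  have hpos : 0 < h := by omega
  have hhm : h ≤ m := by omega
  set E := energy (grid2D m r) x with hE
  have hE0 : 0 ≤ E := energy_nonneg _ _
  set X := squareAverage m h x with hX
  have hH := horizontalEnergy_squareAverage_le (r := r) hpos hhm (by omega) x
  have hW := verticalEnergy_squareAverage_le (r := r) hpos hhm (by omega) x
  set lg := Real.log (m ^ 2 : ℕ) with hlg
  have hlg0 : 0 ≤ lg := Real.log_natCast_nonneg _
  have hM := Nat.div_pos hhm hpos
  have hlog : Real.log ((m / h - 1 : ℕ) + 1) ≤ lg := by
    refine Real.log_le_log (by positivity) ?_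
    have h1 : m / h - 1 + 1 ≤ m ^ 2 := by
      have := Nat.div_le_self m h
      nlinarith [Nat.sub_add_cancel hM]
    exact_mod_cast h1
  have hcoarse : ∀ i : Fin m ×ₗ Fin m,
      (X (blockIndex m h (ofLex i).1) (blockIndex m h (ofLex i).2) -
        rowAverage (m / h - 1) X 0) ^ 2 ≤ (12 + 4 * lg) * (4 * E / (h : ℝ) ^ 4) := by
    intro i
    have h1 := sq_sub_rowAverage_zero_le X
      (Nat.le_sub_one_of_lt (blockIndex_lt hpos hhm (ofLex i).1))
      (Nat.le_sub_one_of_lt (blockIndex_lt hpos hhm (ofLex i).2))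
    refine h1.trans ?_
    have h2 : horizontalEnergy (m / h - 1) X + verticalEnergy (m / h - 1) X ≤
        4 * E / (h : ℝ) ^ 4 := by
      have : 4 * E / (h : ℝ) ^ 4 = 2 * E / (h : ℝ) ^ 4 + 2 * E / (h : ℝ) ^ 4 := by ring
      rw [this]
      exact add_le_add hH hW
    have h3 := horizontalEnergy_nonneg (m / h - 1) X
    have h4 := verticalEnergy_nonneg (m / h - 1) X
    exact mul_le_mul (by linarith) h2 (by linarith) (by linarith)
  have hmid : (X (blockIndex m h (ofLex k).1) (blockIndex m h (ofLex k).2) -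
      X (blockIndex m h (ofLex l).1) (blockIndex m h (ofLex l).2)) ^ 2 ≤
      16 * (12 + 4 * lg) * E / (h : ℝ) ^ 4 := by
    rw [← sub_sub_sub_cancel_right _ _ (rowAverage (m / h - 1) X 0), sub_eq_add_neg]
    refine add_sq_le.trans ?_
    rw [neg_sq]
    have h1 := hcoarse k
    have h2 := hcoarse l
    have h3 : 16 * (12 + 4 * lg) * E / (h : ℝ) ^ 4 =
        4 * ((12 + 4 * lg) * (4 * E / (h : ℝ) ^ 4)) := by ring
    rw [h3]
    linarith
  refine (sq_sub_le_of_three (sq_squareAverage_sub_le (r := r) hpos hhm (by omega) x k) hmid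
    (sq_squareAverage_sub_le (r := r) hpos hhm (by omega) x l)).trans ?_
  have h1 : (1 : ℝ) ≤ h := by exact_mod_cast hpos
  have h2 : (r : ℝ) / 4 ≤ h := by
    have : (r : ℝ) ≤ 4 * h := by exact_mod_cast (by omega : r ≤ 4 * h)
    linarith
  have hr0 : (0 : ℝ) < r := by exact_mod_cast hr
  have h3 : (h : ℝ) ^ 2 ≤ (h : ℝ) ^ 4 := pow_le_pow_right₀ h1 (by norm_num)
  calc 6 * (2 * E / (h : ℝ) ^ 2) + 3 * (16 * (12 + 4 * lg) * E / (h : ℝ) ^ 4)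
      = 12 * E / (h : ℝ) ^ 2 + 576 * E / (h : ℝ) ^ 4 + 192 * lg * E / (h : ℝ) ^ 4 := by ring
    _ ≤ 12 * E / (h : ℝ) ^ 2 + 576 * E / (h : ℝ) ^ 2 + 192 * lg * E / (h : ℝ) ^ 4 := by gcongr
    _ = 588 * E / (h : ℝ) ^ 2 + 192 * lg * E / (h : ℝ) ^ 4 := by ring
    _ ≤ 588 * E / (r / 4 : ℝ) ^ 2 + 192 * lg * E / (r / 4 : ℝ) ^ 4 := by gcongr
    _ = 49152 * (lg / (r : ℝ) ^ 2 + 1) / (r : ℝ) ^ 2 * E - 39744 * E / (r : ℝ) ^ 2 := by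
        field_simp
        ring
    _ ≤ _ := by
        have : 0 ≤ 39744 * E / (r : ℝ) ^ 2 := by positivity
        linarith

open scoped Classical in
omit [NeZero m] in
lemma grid2D_card_edges_le (hr : 1 ≤ r) :
    Fintype.card (OrientedEdge (grid2D m r)) ≤ 9 * (m ^ 2 * r ^ 2) := by
  have h : Fintype.card (OrientedEdge (grid2D m r)) ≤
      Fintype.card ((Fin m ×ₗ Fin m) × Fin (2 * r + 1) × Fin (2 * r + 1)) := by
    have hd : ∀ e : OrientedEdge (grid2D m r),
        |(((ofLex e.1.1).1 : ℕ) : ℤ) - (((ofLex e.1.2).1 : ℕ) : ℤ)| ≤ r ∧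
        |(((ofLex e.1.1).2 : ℕ) : ℤ) - (((ofLex e.1.2).2 : ℕ) : ℤ)| ≤ r := fun e =>
      ⟨(le_add_of_nonneg_right (abs_nonneg _)).trans e.2.1.2,
        (le_add_of_nonneg_left (abs_nonneg _)).trans e.2.1.2⟩
    -- An edge is encoded by its first node and the displacement, shifted by r in each coordinate to
    -- be nonnegative.
    refine Fintype.card_le_of_injective
      (fun e => (e.1.1, ⟨((ofLex e.1.2).1 : ℕ) + r - (ofLex e.1.1).1, ?_⟩,
        ⟨((ofLex e.1.2).2 : ℕ) + r - (ofLex e.1.1).2, ?_⟩)) ?_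
    · have h1 := (hd e).1
      rw [abs_le] at h1
      omega
    · have h1 := (hd e).2
      rw [abs_le] at h1
      omega
    · intro e e' h
      obtain ⟨h1, h2⟩ := Prod.mk.inj h
      obtain ⟨h3, h4⟩ := Prod.mk.inj h2
      have h3' := congrArg Fin.val h3
      have h4' := congrArg Fin.val h4
      simp only at h3' h4'
      have ha := hd e
      have hb := hd e'
      rw [abs_le, abs_le] at ha hb
      rw [← h1] at h3' h4' hb
      have h5 : e.1.2 = e'.1.2 := ofLex.injective
        (Prod.ext (Fin.ext (by omega)) (Fin.ext (by omega)))
      exact Subtype.ext (Prod.ext h1 h5)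
  have h2 : Fintype.card (Fin m ×ₗ Fin m) = m ^ 2 := by
    rw [Fintype.card_lex, Fintype.card_prod, Fintype.card_fin, sq]
  rw [Fintype.card_prod, Fintype.card_prod, Fintype.card_fin, h2] at h
  calc _ ≤ _ := h
    _ ≤ m ^ 2 * (3 * r * (3 * r)) := by gcongr <;> omega
    _ = _ := by ring

end TwoDimensional

/-! ### From resistances to the error bound on both grids. -/

section Corollary

variable {V : Type*} [LinearOrder V] [Fintype V]

open scoped Classical in
/-- On a graph with about `n q` edges of effective resistance `1 / q`, the maximum likelihood
estimate is as accurate as the effective resistances between arbitrary nodes allow. -/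
theorem mle_error_of_locality [Nonempty V] (G : SimpleGraph V) {L : ℕ}
    {θs : V → ℝ} {κ δ q X : ℝ} (hκ : 1 ≤ κ) (hδ : 0 < δ) (hδ1 : δ < 1) (hq : 0 < q) (hX : 0 < X)
    (hsum : ∑ i, θs i = 0) (hstar : ∀ i j, G.Adj i j → |θs i - θs j| ≤ Real.log κ)
    (hedge : ∀ k l (x : V → ℝ), G.Adj k l → (x k - x l) ^ 2 ≤ 1728 / q * energy G x)
    (hall : ∀ k l (x : V → ℝ), (x k - x l) ^ 2 ≤ 49152 * X / q * energy G x)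
    (hcard : (Fintype.card (OrientedEdge G) : ℝ) ≤ 9 * (Fintype.card V * q))
    (hcond : 200000000000 * (κ ^ 5 * Fintype.card V * Real.log (Fintype.card V / δ)) ≤ q * L)
    {Ω : Type*} [MeasurableSpace Ω] (P : Measure Ω) [IsProbabilityMeasure P]
    {y : OrientedEdge G → Fin L → Ω → ℝ} (hy : IsSample P G L θs y) :
    ∃ A : Set Ω, MeasurableSet A ∧ ENNReal.ofReal (1 - δ) ≤ P A ∧ ∀ ω ∈ A,
      (∃! θ : V → ℝ, IsMLE G L (fun e l => y e l ω) θ) ∧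
      ∀ θ : V → ℝ, IsMLE G L (fun e l => y e l ω) θ →
        ∀ k l : V, |(θ k - θ l) - (θs k - θs l)| ≤
          2000 * (κ * √(X * (1 / (q * L)) * Real.log (Fintype.card V / δ))) := by
  set n : ℝ := (Fintype.card V : ℝ) with hn
  have hn1 : 1 ≤ n := by
    rw [hn]; exact_mod_cast Fintype.card_pos
  have hlog : 0 < Real.log (n / δ) := Real.log_pos (by rw [lt_div_iff₀ hδ]; linarith)
  have hL : 0 < L := by
    rcases Nat.eq_zero_or_pos L with h | h
    · rw [h, Nat.cast_zero, mul_zero] at hcond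
      have : 0 < 200000000000 * (κ ^ 5 * n * Real.log (n / δ)) := by positivity
      linarith
    · exact h
  have hL' : (0 : ℝ) < L := by exact_mod_cast hL
  -- The minimum keeps `ρ` below R on edges and below the global bound everywhere.
  set ρ : V → V → ℝ := fun k l => if G.Adj k l then min (1728 / q) (49152 * X / q)
    else 49152 * X / q with hρdef
  have hρle : ∀ k l, ρ k l ≤ 49152 * X / q := fun k l => by
    simp only [hρdef]
    split_ifs
    · exact min_le_right _ _
    · exact le_rfl
  have hρ0 : ∀ k l, 0 < ρ k l := fun k l => by
    simp only [hρdef]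
    split_ifs <;> positivity
  obtain ⟨A, hA, hPA, hAω⟩ := mle_error_of_resistance_bound G hL (θs := θs) (κ := κ) (δ := δ)
    (R := 1728 / q) (ρ := ρ) hκ hδ hδ1 (by positivity) hρ0
    (fun k l => by simp only [hρdef, G.adj_comm]) hsum hstar
    (fun k l x => by
      simp only [hρdef]
      split_ifs with h
      · rw [min_mul_of_nonneg _ _ (energy_nonneg G x)]
        exact le_min (hedge k l x h) (hall k l x)
      · exact hall k l x)
    (fun k l h => by simp only [hρdef, if_pos h]; exact min_le_left _ _)
    (by
      rw [← hn]
      have h1 : κ ^ 4 ≤ κ ^ 5 := pow_le_pow_right₀ hκ (by norm_num)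
      have h2 : 4096 * κ ^ 4 * (1728 / q) ^ 2 * (Fintype.card (OrientedEdge G) : ℝ) *
          Real.log (n / δ) ≤ 4096 * κ ^ 5 * (1728 / q) ^ 2 * (9 * (n * q)) * Real.log (n / δ) := by
        gcongr
      refine h2.trans ?_
      have h3 : 4096 * κ ^ 5 * (1728 / q) ^ 2 * (9 * (n * q)) * Real.log (n / δ) =
          110075314176 * (κ ^ 5 * n * Real.log (n / δ)) / q := by
        field_simp
        norm_num
      rw [h3, div_le_iff₀ hq]
      have h4 : 0 < κ ^ 5 * n * Real.log (n / δ) := by positivity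
      linarith)
    P hy
  refine ⟨A, hA, hPA, fun ω hω => ⟨(hAω ω hω).1, fun θ hθ k l => ?_⟩⟩
  refine ((hAω ω hω).2 θ hθ k l).trans ?_
  rw [← hn]
  have h1 : ρ k l * (Real.log (n / δ) / L) ≤
      222 ^ 2 * (X * (1 / (q * L)) * Real.log (n / δ)) := by
    calc _ ≤ 49152 * X / q * (Real.log (n / δ) / L) := by gcongr; exact hρle k l
      _ = 49152 * (X * (1 / (q * L)) * Real.log (n / δ)) := by field_simp
      -- 222² slightly exceeds 49152, and 8 · 222 = 1776 ≤ 2000.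
      _ ≤ _ := by gcongr; norm_num
  have h2 := Real.sqrt_le_sqrt h1
  rw [Real.sqrt_mul (by positivity : (0 : ℝ) ≤ 222 ^ 2), Real.sqrt_sq (by norm_num)] at h2
  have h3 := Real.sqrt_nonneg (X * (1 / (q * L)) * Real.log (n / δ))
  calc _ ≤ 8 * κ * (222 * √(X * (1 / (q * L)) * Real.log (n / δ))) := by gcongr
    _ = 1776 * (κ * √(X * (1 / (q * L)) * Real.log (n / δ))) := by ring
    _ ≤ _ := by gcongr; norm_num

/-- Without nodes there is nothing to estimate. -/
lemma mle_error_of_isEmpty [IsEmpty V] (G : SimpleGraph V) {L : ℕ} {θs : V → ℝ} {δ : ℝ}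
    (hδ : 0 < δ) (D : ℝ)
    {Ω : Type*} [MeasurableSpace Ω] (P : Measure Ω) [IsProbabilityMeasure P]
    (y : OrientedEdge G → Fin L → Ω → ℝ) :
    ∃ A : Set Ω, MeasurableSet A ∧ ENNReal.ofReal (1 - δ) ≤ P A ∧ ∀ ω ∈ A,
      (∃! θ : V → ℝ, IsMLE G L (fun e l => y e l ω) θ) ∧
      ∀ θ : V → ℝ, IsMLE G L (fun e l => y e l ω) θ →
        ∀ k l : V, |(θ k - θ l) - (θs k - θs l)| ≤ D := by
  refine ⟨Set.univ, MeasurableSet.univ, ?_, fun ω _ => ⟨⟨0, ⟨by simp, fun θ _ => ?_⟩, fun θ _ =>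
    Subsingleton.elim _ _⟩, fun θ _ k => isEmptyElim k⟩⟩
  · rw [measure_univ, ← ENNReal.ofReal_one]
    exact ENNReal.ofReal_le_ofReal (by linarith)
  · rw [Subsingleton.elim θ 0]
    exact le_refl (loss G L (fun e l => y e l ω) 0)

end Corollary

end BTL

theorem corollary2 :
    ∃ C₁ C₂ : ℝ, 0 < C₁ ∧ 0 < C₂ ∧
      -- one-dimensional grids
      (∀ (n r L : ℕ) (θstar : Fin n → ℝ) (κE δ : ℝ)
          (Ω : Type*) [MeasurableSpace Ω] (P : Measure Ω) [IsProbabilityMeasure P]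
          (y : BTL.OrientedEdge (BTL.grid1D n r) → Fin L → Ω → ℝ),
        r ≤ n →
        ∑ i, θstar i = 0 →
        1 ≤ κE →
        (∀ i j, (BTL.grid1D n r).Adj i j → |θstar i - θstar j| ≤ Real.log κE) →
        0 < δ → δ < 1 →
        BTL.IsSample P (BTL.grid1D n r) L θstar y →
        C₁ * (κE ^ 5 * n * Real.log (n / δ)) ≤ (r : ℝ) * L →
        ∃ A : Set Ω, MeasurableSet A ∧ ENNReal.ofReal (1 - δ) ≤ P A ∧ ∀ ω ∈ A,
          (∃! θ : Fin n → ℝ, BTL.IsMLE (BTL.grid1D n r) L (fun e l => y e l ω) θ) ∧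
          ∀ θ : Fin n → ℝ, BTL.IsMLE (BTL.grid1D n r) L (fun e l => y e l ω) θ →
            ∀ k l : Fin n, |(θ k - θ l) - (θstar k - θstar l)| ≤
              C₂ * (κE * √(((n : ℝ) / (r : ℝ) ^ 2 + 1) * (1 / ((r : ℝ) * L)) *
                Real.log (n / δ)))) ∧
      -- two-dimensional grids
      (∀ (n m r L : ℕ) (θstar : Fin m ×ₗ Fin m → ℝ) (κE δ : ℝ)
          (Ω : Type*) [MeasurableSpace Ω] (P : Measure Ω) [IsProbabilityMeasure P]
          (y : BTL.OrientedEdge (BTL.grid2D m r) → Fin L → Ω → ℝ),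
        n = m ^ 2 →
        r ≤ 2 * m →
        ∑ i, θstar i = 0 →
        1 ≤ κE →
        (∀ i j, (BTL.grid2D m r).Adj i j → |θstar i - θstar j| ≤ Real.log κE) →
        0 < δ → δ < 1 →
        BTL.IsSample P (BTL.grid2D m r) L θstar y →
        C₁ * (κE ^ 5 * n * Real.log (n / δ)) ≤ (r : ℝ) ^ 2 * L →
        ∃ A : Set Ω, MeasurableSet A ∧ ENNReal.ofReal (1 - δ) ≤ P A ∧ ∀ ω ∈ A,
          (∃! θ : Fin m ×ₗ Fin m → ℝ, BTL.IsMLE (BTL.grid2D m r) L (fun e l => y e l ω) θ) ∧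
          ∀ θ : Fin m ×ₗ Fin m → ℝ, BTL.IsMLE (BTL.grid2D m r) L (fun e l => y e l ω) θ →
            ∀ k l : Fin m ×ₗ Fin m, |(θ k - θ l) - (θstar k - θstar l)| ≤
              C₂ * (κE * √((Real.log n / (r : ℝ) ^ 2 + 1) * (1 / ((r : ℝ) ^ 2 * L)) *
                Real.log (n / δ)))) := by
  refine ⟨200000000000, 2000, by norm_num, by norm_num, ?_, ?_⟩
  · intro n r L θs κ δ Ω _ P _ y hrn hsum hκ hstar hδ hδ1 hy hcond
    rcases Nat.eq_zero_or_pos n with rfl | hn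
    · exact BTL.mle_error_of_isEmpty _ hδ _ P y
    have hn' : (1 : ℝ) ≤ n := by exact_mod_cast hn
    have hlog : 0 < Real.log (n / δ) := Real.log_pos (by rw [lt_div_iff₀ hδ]; linarith)
    -- For r = 0 the sample size condition would bound a positive number by 0.
    have hr : 1 ≤ r := by
      by_contra h
      have h0 : r = 0 := by omega
      rw [h0, Nat.cast_zero, zero_mul] at hcond
      have : 0 < 200000000000 * (κ ^ 5 * n * Real.log (n / δ)) := by positivity
      linarith
    have hr' : (0 : ℝ) < r := by exact_mod_cast hr
    have : Nonempty (Fin n) := ⟨⟨0, hn⟩⟩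
    have h := BTL.mle_error_of_locality (BTL.grid1D n r) (q := r)
      (X := (n : ℝ) / (r : ℝ) ^ 2 + 1) hκ hδ hδ1 hr' (by positivity) hsum hstar
      (fun k l x hkl => (BTL.grid1D_resistance_edge hr hrn hkl x).trans
        (mul_le_mul_of_nonneg_right (by gcongr; norm_num) (BTL.energy_nonneg _ _)))
      (fun k l x => (BTL.grid1D_resistance hr hrn k l x).trans
        (mul_le_mul_of_nonneg_right (by gcongr; norm_num) (BTL.energy_nonneg _ _)))
      (by
        rw [Fintype.card_fin]
        refine (Nat.cast_le.2 (BTL.grid1D_card_edges_le hr)).trans ?_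
        push_cast
        have h2 : (0 : ℝ) ≤ n * r := by positivity
        linarith)
      (by rw [Fintype.card_fin]; exact hcond) P hy
    rwa [Fintype.card_fin] at h
  · intro n m r L θs κ δ Ω _ P _ y hnm hrm hsum hκ hstar hδ hδ1 hy hcond
    rcases Nat.eq_zero_or_pos m with rfl | hm
    · have : IsEmpty (Fin 0 ×ₗ Fin 0) := ⟨fun i => (ofLex i).1.elim0⟩
      exact BTL.mle_error_of_isEmpty _ hδ _ P y
    have hn : 1 ≤ n := by rw [hnm]; exact Nat.one_le_pow _ _ hm
    have hn' : (1 : ℝ) ≤ n := by exact_mod_cast hn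
    have hlog : 0 < Real.log (n / δ) := Real.log_pos (by rw [lt_div_iff₀ hδ]; linarith)
    have hlogn : 0 ≤ Real.log n := Real.log_natCast_nonneg n
    have hr : 1 ≤ r := by
      by_contra h
      have h0 : r = 0 := by omega
      rw [h0, Nat.cast_zero, zero_pow two_ne_zero, zero_mul] at hcond
      have : 0 < 200000000000 * (κ ^ 5 * n * Real.log (n / δ)) := by positivity
      linarith
    have hr' : (0 : ℝ) < r := by exact_mod_cast hr
    have : Nonempty (Fin m ×ₗ Fin m) := ⟨toLex (⟨0, hm⟩, ⟨0, hm⟩)⟩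
    have hV : Fintype.card (Fin m ×ₗ Fin m) = n := by
      rw [Fintype.card_lex, Fintype.card_prod, Fintype.card_fin, hnm, sq]
    have h := BTL.mle_error_of_locality (BTL.grid2D m r) (q := (r : ℝ) ^ 2)
      (X := Real.log n / (r : ℝ) ^ 2 + 1) hκ hδ hδ1 (by positivity) (by positivity) hsum hstar
      (fun k l x hkl => BTL.grid2D_resistance_edge hm hr hrm hkl x)
      (fun k l x => by rw [hnm]; exact BTL.grid2D_resistance hm hr hrm k l x)
      (by
        rw [hV, hnm]
        exact_mod_cast BTL.grid2D_card_edges_le hr)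
      (by rw [hV]; exact hcond) P hy
    rwa [hV] at h
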